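/- Let $(X,d)$ be a geodesic, possibly asymmetric, metric space: $d\ge 0$, $d(x,y)=0$ iff $x=y$, the triangle inequality holds, and for all $x,y\in X$ there is $\gamma:[0,d(x,y)]\to X$ from $x$ to $y$ with $d(\gamma(s),\gamma(t))=t-s$ for $s\le t$. Put $d^+(x,y)=d(x,y)$, $d^-(x,y)=d(y,x)$, $d^{sym}=\max(d^+,d^-)$, and let $o\in X$. For $z\in X$ let $h_z^\pm(x)=d^\pm(x,z)-d^\pm(o,z)$, and let $\partial_h^\pm X=\overline{h^\pm(X)}\smallsetminus h^\pm(X)$, the closure being taken in the space $\mathcal C(X)$ of real continuous functions on $(X,d^{sym})$ with the topology of uniform convergence on compact sets; write $h_x^\pm$ for the function corresponding to $x\in\partial_h^\pm X$. Let $$(x|y)_o=-\tfrac12\inf_{z\in X}\big(h_x^-(z)+h_y^+(z)\big)\in(-\infty,+\infty]\qquad (x\in\partial_h^-X,\ y\in\partial_h^+X).$$ Let $G$ be a countable group acting by isometries on $(X,d)$. It acts on $\partial_h^\pm X$ by $(g\cdot h)(z)=h(g^{-1}z)-h(g^{-1}o)$, and $\beta^\pm(g,x)=h_x^\pm(g^{-1}o)$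 is the Busemann cocycle. Let $\mu$ be a probability measure on $G$ with $\int_G d^{sym}(go,o)^2\,d\mu(g)<+\infty$, let $\mu^{*n}$ be its convolution powers and $\check\mu(g)=\mu(g^{-1})$. A probability measure $\nu$ on a $G$-space is $\mu$-stationary if $\nu(S)=\int_G\nu(g^{-1}S)\,d\mu(g)$ for all measurable $S$; it is moreover $\mu$-ergodic if every measurable $S$ such that $g^{-1}S=S$ modulo $\nu$-null sets for $\mu$-a.e. $g$ satisfies $\nu(S)\in\{0,1\}$. Let $Y^-\subseteq\partial_h^-X$ be a $G$-invariant Borel subset carrying a $\mu$-ergodic $\mu$-stationary Borel probability measure $\nu$, and let $Y^+\subseteq\partial_h^+X$ be a $G$-invariant subset carrying a $\check\mu$-stationary Borel probability measure $\nu^*$. Let $\lambda\in\mathbb R$ and assume: - **(H1)** $\displaystyle\int_{G\times Y^+}\beta^+(g,y)\,d\check\mu(g)\,d\nu^*(y)=\lambda$; - **(H2)** there are $\alpha>0$ and a summable sequence $(C_n)_{n\in\mathbb N}$ such that $\nu^*(\{y\in Y^+ : (x|y)_o\ge\alpha n\})\le C_n$ for all $x\in Y^-$ and all $n\in\mathbb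 N$. Then $\beta^-|_{Y^-}$ is $\mu$-centerable with average $\lambda$: there are a bounded measurable $\psi:Y^-\to\mathbb R$ and a measurable cocycle $\beta_0^-:G\times Y^-\to\mathbb R$ with $\int_G\beta_0^-(g,x)\,d\mu(g)=\lambda$ for all $x\in Y^-$ (the integral converging absolutely), such that $$\beta^-(g,x)=\beta_0^-(g,x)+\psi(x)-\psi(gx)\qquad (g\in G,\ x\in Y^-).$$ Moreover, in any such decomposition of $\beta^-|_{Y^-}$ with $\int_G\beta_0^-(g,x)\,d\mu(g)=c$ for all $x$ and some constant $c$, one has $c=\lambda$, the variance $$V_\nu=\int_{G\times Y^-}(\beta_0^-(g,x)-\lambda)^2\,d\mu(g)\,d\nu(x)$$ is finite, and, with $N_\nu$ the centered Gaussian law on $\mathbb R$ of variance $V_\nu$ (the Dirac mass at $0$ if $V_\nu=0$), for $\nu$-a.e. $x\in Y^-$ and every compactly supported continuous $F:\mathbb R\to\mathbb R$, $$\lim_{n\to+\infty}\int_G F\left(\frac{\beta^-(g,x)-n\lambda}{\sqrt n}\right)d\mu^{*n}(g)=\int_{\mathbb R}F(t)\,dN_\nu(t).$$ -/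

import Mathlib

open MeasureTheory ProbabilityTheory Filter Topology

/-! ### Asymmetric metric spaces -/

/-- A possibly asymmetric metric: a nonnegative function satisfying the separation axiom and the
triangle inequality, but not necessarily symmetric. -/
class AsymMetricSpace (X : Type*) where
  /-- the asymmetric distance `d(x, y)` from `x` to `y` -/
  adist : X → X → ℝ
  adist_nonneg : ∀ x y, 0 ≤ adist x y
  adist_eq_zero_iff : ∀ x y, adist x y = 0 ↔ x = y
  adist_triangle : ∀ x y z, adist x z ≤ adist x y + adist y z

open AsymMetricSpace

/-- The symmetrized metric `d^sym(x, y) = max (d(x, y)) (d(y, x))`. Topological notions on `X`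
(continuity, compactness), and `dist` on `X`, always refer to this metric. -/
noncomputable instance AsymMetricSpace.toMetricSpace (X : Type*) [AsymMetricSpace X] :
    MetricSpace X where
  dist x y := max (adist x y) (adist y x)
  dist_self x := by simp [(adist_eq_zero_iff x x).2 rfl]
  dist_comm x y := max_comm _ _
  dist_triangle x y z := by
    apply max_le
    · exact (adist_triangle x y z).trans (add_le_add (le_max_left _ _) (le_max_left _ _))
    · refine (adist_triangle z y x).trans ?_
      rw [add_comm]
      exact add_le_add (le_max_right _ _) (le_max_right _ _)
  eq_of_dist_eq_zero {x y} h :=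
    (adist_eq_zero_iff x y).1
      (le_antisymm ((le_max_left (adist x y) (adist y x)).trans_eq h) (adist_nonneg x y))

/-- `X` is geodesic: any `x` is joined to any `y` by a path `γ : [0, d(x, y)] → X` along which
`d(γ s, γ t) = t - s` for `s ≤ t`. -/
def IsGeodesicSpace (X : Type*) [AsymMetricSpace X] : Prop :=
  ∀ x y : X, ∃ γ : ℝ → X, γ 0 = x ∧ γ (adist x y) = y ∧
    ∀ s t : ℝ, 0 ≤ s → s ≤ t → t ≤ adist x y → adist (γ s) (γ t) = t - s

/-- The action of `G` on `X` is by isometries of the asymmetric metric. -/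
class IsAsymIsometricAction (G X : Type*) [Group G] [AsymMetricSpace X] [MulAction G X] :
    Prop where
  adist_smul : ∀ (g : G) (x y : X), adist (g • x) (g • y) = adist x y

/-- `fwd` stands for the metric `d⁺ = d`, `bwd` for the reversed metric `d⁻(x, y) = d(y, x)`. -/
inductive Direction
  | fwd
  | bwd

/-- The forward metric `d⁺` and the backward metric `d⁻`. -/
def ddist {X : Type*} [AsymMetricSpace X] : Direction → X → X → ℝ
  | .fwd, x, y => adist x y
  | .bwd, x, y => adist y x

/-! ### Horoboundaries -/

section Horo

variable {X : Type*} [AsymMetricSpace X]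

theorem continuous_ddist (s : Direction) (z : X) : Continuous fun x : X => ddist s x z := by
  refine (LipschitzWith.of_le_add_mul 1 fun x y => ?_).continuous
  simp only [NNReal.coe_one, one_mul]
  cases s
  · have h1 := adist_triangle x y z
    have h2 : adist x y ≤ dist x y := le_max_left _ _
    simp only [ddist]
    linarith
  · have h1 := adist_triangle z y x
    have h2 : adist y x ≤ dist x y := le_max_right _ _
    simp only [ddist]
    linarith

/-- The function `h_z : x ↦ d(x, z) - d(o, z)`, for `d = d⁺` or `d = d⁻`. -/
noncomputable def horofunction (s : Direction) (o z : X) : C(X, ℝ) where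
  toFun x := ddist s x z - ddist s o z
  continuous_toFun := (continuous_ddist s z).sub continuous_const

/-- The horofunction boundary, as a subset of `C(X, ℝ)` with the topology of uniform convergence on
compact sets: the closure of `{h_z | z ∈ X}` minus `{h_z | z ∈ X}`. -/
def horoboundarySet (s : Direction) (o : X) : Set C(X, ℝ) :=
  closure (Set.range (horofunction s o)) \ Set.range (horofunction s o)

/-- The horofunction boundary `∂_h^± X`. -/
def HoroBoundary (s : Direction) (o : X) : Type _ := {h : C(X, ℝ) // h ∈ horoboundarySet s o}

noncomputable instance (s : Direction) (o : X) : TopologicalSpace (HoroBoundary s o) :=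
  inferInstanceAs (TopologicalSpace {h : C(X, ℝ) // h ∈ horoboundarySet s o})

noncomputable instance (s : Direction) (o : X) : MeasurableSpace (HoroBoundary s o) := borel _

instance (s : Direction) (o : X) : BorelSpace (HoroBoundary s o) := ⟨rfl⟩

noncomputable instance (s : Direction) (o : X) : CoeFun (HoroBoundary s o) fun _ => X → ℝ := ⟨fun h => h.1⟩

/-- The extended Gromov product `(x|y)_o = -(1/2) inf_{z ∈ X} (h⁻_x(z) + h⁺_y(z))`, which may be
infinite. -/
noncomputable def gromovProduct {o : X} (x : HoroBoundary .bwd o) (y : HoroBoundary .fwd o) :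
    EReal :=
  ((-(1 / 2) : ℝ) : EReal) * ⨅ z : X, ((x z + y z : ℝ) : EReal)

variable {G : Type*} [Group G] [MulAction G X] [IsAsymIsometricAction G X]

theorem ddist_smul (s : Direction) (g : G) (x y : X) : ddist s (g • x) (g • y) = ddist s x y := by
  cases s <;> exact IsAsymIsometricAction.adist_smul g _ _

theorem ddist_inv_smul (s : Direction) (g : G) (x y : X) :
    ddist s (g⁻¹ • x) y = ddist s x (g • y) := by
  rw [← ddist_smul s g, smul_inv_smul]

theorem continuous_asym_smul (g : G) : Continuous fun x : X => g • x := by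
  refine Isometry.continuous (Isometry.of_dist_eq fun x y => ?_)
  change max (adist _ _) (adist _ _) = max (adist _ _) (adist _ _)
  rw [IsAsymIsometricAction.adist_smul, IsAsymIsometricAction.adist_smul]

/-- `(g h)(z) = h(g⁻¹ z) - h(g⁻¹ o)`. -/
noncomputable def horoTranslate (o : X) (g : G) (h : C(X, ℝ)) : C(X, ℝ) where
  toFun z := h (g⁻¹ • z) - h (g⁻¹ • o)
  continuous_toFun := (h.continuous.comp (continuous_asym_smul g⁻¹)).sub continuous_const

theorem continuous_horoTranslate (o : X) (g : G) :
    Continuous (horoTranslate o g : C(X, ℝ) → C(X, ℝ)) := by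
  have h1 : Continuous fun h : C(X, ℝ) => h.comp ⟨fun x : X => g⁻¹ • x, continuous_asym_smul g⁻¹⟩ :=
    ContinuousMap.continuous_precomp _
  have h2 : Continuous fun h : C(X, ℝ) => ContinuousMap.const X (h (g⁻¹ • o)) :=
    ContinuousMap.continuous_const'.comp (continuous_eval_const _)
  exact h1.sub h2

theorem horoTranslate_horofunction (s : Direction) (o z : X) (g : G) :
    horoTranslate o g (horofunction s o z) = horofunction s o (g • z) := by
  ext x
  simp [horoTranslate, horofunction, ddist_inv_smul]

theorem horoTranslate_mul (o : X) (g k : G) (h : C(X, ℝ)) :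
    horoTranslate o (g * k) h = horoTranslate o g (horoTranslate o k h) := by
  ext x
  simp [horoTranslate, mul_smul]

theorem horo_apply_base {s : Direction} {o : X} {h : C(X, ℝ)}
    (hh : h ∈ closure (Set.range (horofunction s o))) : h o = 0 := by
  have hc : IsClosed {h : C(X, ℝ) | h o = 0} :=
    isClosed_eq (continuous_eval_const o) continuous_const
  refine closure_minimal ?_ hc hh
  rintro _ ⟨z, rfl⟩
  simp [horofunction]

theorem horoTranslate_one {s : Direction} {o : X} {h : C(X, ℝ)}
    (hh : h ∈ closure (Set.range (horofunction s o))) : horoTranslate o (1 : G) h = h := by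
  ext x
  simp [horoTranslate, horo_apply_base hh]

theorem horoTranslate_mem {s : Direction} {o : X} (g : G) {h : C(X, ℝ)}
    (hh : h ∈ horoboundarySet s o) : horoTranslate o g h ∈ horoboundarySet s o := by
  refine ⟨?_, ?_⟩
  · refine map_mem_closure (continuous_horoTranslate o g) hh.1 ?_
    rintro _ ⟨z, rfl⟩
    exact ⟨g • z, (horoTranslate_horofunction s o z g).symm⟩
  · rintro ⟨z, hz⟩
    refine hh.2 ⟨g⁻¹ • z, ?_⟩
    rw [← horoTranslate_horofunction, hz, ← horoTranslate_mul, inv_mul_cancel,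
      horoTranslate_one hh.1]

/-- The action of `G` on the horofunction boundary. -/
noncomputable instance (s : Direction) (o : X) : MulAction G (HoroBoundary s o) where
  smul g h := ⟨horoTranslate o g h.1, horoTranslate_mem g h.2⟩
  one_smul h := Subtype.ext (horoTranslate_one h.2.1)
  mul_smul g k h := Subtype.ext (horoTranslate_mul o g k h.1)

/-- The Busemann cocycle `β^±(g, x) = h_x(g⁻¹ o)`. -/
noncomputable def busemann {s : Direction} {o : X} (g : G) (x : HoroBoundary s o) : ℝ := x (g⁻¹ • o)

end Horo

/-! ### Random walks, stationary measures and cocycles -/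

section Walk

variable {G : Type*} [Group G] [MeasurableSpace G]

/-- The convolution power `μ^{*n}`: the law of `s_n ⋯ s_1` for independent `s_i` of law `μ`. -/
noncomputable def convPow (μ : Measure G) : ℕ → Measure G
  | 0 => Measure.dirac 1
  | n + 1 => μ.mconv (convPow μ n)

variable {Y : Type*} [MeasurableSpace Y] [MulAction G Y]

/-- `ν` is `μ`-stationary: `ν = μ * ν`, where `(μ * ν)(S) = ∫ ν(g⁻¹ S) dμ(g)`. -/
def IsStationaryMeasure (μ : Measure G) (ν : Measure Y) : Prop :=
  ∀ S : Set Y, MeasurableSet S → ν S = ∫⁻ g, ν ((fun y => g • y) ⁻¹' S) ∂μ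

/-- A (stationary) probability measure `ν` is `μ`-ergodic: a measurable set `S` with `g⁻¹ S = S`
up to `ν`-null sets for `μ`-almost every `g` is `ν`-null or `ν`-conull. For stationary `ν` this is
equivalent to extremality of `ν` among the `μ`-stationary probability measures. -/
def IsWalkErgodic (μ : Measure G) (ν : Measure Y) : Prop :=
  ∀ S : Set Y, MeasurableSet S → (∀ᵐ g ∂μ, (fun y => g • y) ⁻¹' S =ᵐ[ν] S) → ν S = 0 ∨ ν Sᶜ = 0

/-- `σ : G × Y → ℝ` is a cocycle. -/
def IsCocycle (σ : G → Y → ℝ) : Prop :=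
  ∀ (g h : G) (y : Y), σ (g * h) y = σ g (h • y) + σ h y

/-- `σ` has constant drift `c` with respect to `μ`. -/
def HasConstantDrift (μ : Measure G) (σ : G → Y → ℝ) (c : ℝ) : Prop :=
  ∀ y : Y, Integrable (fun g => σ g y) μ ∧ ∫ g, σ g y ∂μ = c

/-- `σ(g, y) = σ₀(g, y) + ψ(y) - ψ(g y)`, where `σ₀` is a measurable cocycle with constant drift
`c`, and `ψ` is a bounded measurable function. -/
structure IsCentering (μ : Measure G) (σ σ₀ : G → Y → ℝ) (ψ : Y → ℝ) (c : ℝ) : Prop where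
  cocycle : IsCocycle σ₀
  measurable_cocycle : Measurable fun p : G × Y => σ₀ p.1 p.2
  drift : HasConstantDrift μ σ₀ c
  measurable_psi : Measurable ψ
  bounded_psi : ∃ M : ℝ, ∀ y, |ψ y| ≤ M
  eq : ∀ g y, σ g y = σ₀ g y + ψ y - ψ (g • y)

/-- `σ` is `μ`-centerable with average `c`. -/
def IsCenterable (μ : Measure G) (σ : G → Y → ℝ) (c : ℝ) : Prop :=
  ∃ (σ₀ : G → Y → ℝ) (ψ : Y → ℝ), IsCentering μ σ σ₀ ψ c

/-- The variance `V_ν = ∫ (σ₀(g, x) - c)² dμ(g) dν(x)`. -/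
noncomputable def cocycleVariance (μ : Measure G) (ν : Measure Y) (σ₀ : G → Y → ℝ) (c : ℝ) : ℝ :=
  ∫ p : G × Y, (σ₀ p.1 p.2 - c) ^ 2 ∂(μ.prod ν)

end Walk

/-!
The proof has two independent halves.

**Centering.** Horofunctions satisfy `2 (g x|g y) = 2 (x|y) + β⁻(g, x) + β⁺(g, y)`. With
`ψ(x) = -2 ∫ (x|y) dν*(y)`, which is bounded by the tail assumption, the cocycle
`β⁻(g, x) - ψ(x) + ψ(g x)` equals `2 ∫ (x|y) - 2 ∫ (x|g⁻¹ y) + ∫ β⁺(g⁻¹, y)` (integrals against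
`ν*`), whose `μ`-average is `λ` by stationarity of `ν*` under the reflected walk. Since `X` need not
be separable, the infimum over `X` defining the Gromov product may fail to be measurable in a
useful sense. It is replaced by the infimum over the orbit of the base point (`orbitProduct`): this
is a countable infimum, it satisfies the same identity, and it gives a smaller nonnegative product,
so the tail assumption persists. See `isCenterable_of_orbitProduct`. The drift of a centering is
unique because a bounded coboundary has zero integral over a stationary space
(`IsCentering.drift_unique`).

**Central limit theorem.** By Lévy's theorem it is enough to follow characteristic functions, which
are computed by iterating transfer operators; no path space is needed. Let `V(y)` be the variance of
the increment of the centered cocycle at `y`, with mean `v` against `ν`. If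
`V - v = U - P U + R`, where `P` is the Markov operator, the function `1 - (s²/2) U` is multiplied
by `exp(-s² v / 2)` under the transfer operator, up to an error `o(s²) + (s²/2) |R|`
(`norm_twistedExpectation_one_sub_le`). With `s = t / √n`, the limit law is Gaussian at any `x`
where `R` can be chosen with arbitrarily small averages along the walk (`IsAlmostCoboundaryAt`). Taking
for `R` the ergodic averages of `V - v`, these remainders tend to `0` in `L¹(ν)` by the mean ergodic
theorem for `P` (`tendsto_integral_abs_ergodicAverage`), and the maximal ergodic inequality
(`measure_exists_lt_sum_le`) controls their averages along the walk from almost every point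
(`ae_isAlmostCoboundaryAt`).
-/

/-! ### Random walks on a countable group -/

section RandomWalk

variable {G : Type*} [Countable G] [MeasurableSpace G] [DiscreteMeasurableSpace G]

/-- On a countable discrete space, a bounded function is integrable for every finite measure. -/
theorem integrable_of_forall_norm_le {E : Type*} [NormedAddCommGroup E] (m : Measure G)
    [IsFiniteMeasure m] {H : G → E} {C : ℝ} (hH : ∀ g, ‖H g‖ ≤ C) : Integrable H m :=
  Integrable.of_bound AEStronglyMeasurable.of_discrete C (Eventually.of_forall hH)

variable [Group G]

instance isProbabilityMeasure_convPow (μ : Measure G) [IsProbabilityMeasure μ] (n : ℕ) :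
    IsProbabilityMeasure (convPow μ n) := by
  induction n with
  | zero => exact inferInstanceAs (IsProbabilityMeasure (Measure.dirac (1 : G)))
  | succ n ih =>
    exact Measure.isProbabilityMeasure_map Measurable.of_discrete.aemeasurable

/-- Integration along the last step of the random walk: `μ^{*(k+1)}` is the law of `a * b`, with
`a` of law `μ` independent of `b` of law `μ^{*k}`. -/
theorem integral_convPow_succ {E : Type*} [NormedAddCommGroup E] [NormedSpace ℝ E]
    (μ : Measure G) [IsProbabilityMeasure μ] (k : ℕ) {H : G → E} {C : ℝ} (hH : ∀ g, ‖H g‖ ≤ C) :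
    ∫ g, H g ∂(convPow μ (k + 1)) = ∫ b, ∫ a, H (a * b) ∂μ ∂(convPow μ k) := by
  change ∫ g, H g ∂(Measure.map (fun x : G × G ↦ x.1 * x.2) (μ.prod (convPow μ k))) = _
  rw [integral_map Measurable.of_discrete.aemeasurable AEStronglyMeasurable.of_discrete,
    integral_prod_symm]
  exact Integrable.of_bound AEStronglyMeasurable.of_discrete C (Eventually.of_forall fun p ↦ hH _)

end RandomWalk

/-! ### Stationary measures -/

section Stationary

variable {G : Type*} [Group G] [Countable G] [MeasurableSpace G] [DiscreteMeasurableSpace G]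
  {Y : Type*} [MeasurableSpace Y] [MulAction G Y] [MeasurableConstSMul G Y]

theorem measurable_smul_prod : Measurable fun p : G × Y => p.1 • p.2 :=
  measurable_from_prod_countable_right fun g => measurable_const_smul g

/-- Stationarity of `ν` says that the action map `G × Y → Y` sends `μ ⊗ ν` to `ν`. -/
theorem IsStationaryMeasure.measurePreserving {μ : Measure G} {ν : Measure Y} [SFinite ν]
    (h : IsStationaryMeasure μ ν) :
    MeasurePreserving (fun p : G × Y => p.1 • p.2) (μ.prod ν) ν := by
  refine ⟨measurable_smul_prod, ?_⟩
  ext S hS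
  rw [Measure.map_apply measurable_smul_prod hS,
    Measure.prod_apply (measurable_smul_prod hS), h S hS]
  rfl

theorem IsStationaryMeasure.integral_smul {μ : Measure G} [SFinite μ] {ν : Measure Y} [SFinite ν]
    (h : IsStationaryMeasure μ ν) {f : Y → ℝ} (hf : Integrable f ν) :
    ∫ g, ∫ y, f (g • y) ∂ν ∂μ = ∫ y, f y ∂ν := by
  rw [← integral_prod (f := fun p : G × Y => f (p.1 • p.2))
    (h.measurePreserving.integrable_comp_of_integrable hf)]
  conv_rhs => rw [← h.measurePreserving.map_eq]
  rw [integral_map h.measurePreserving.aemeasurable]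
  rw [h.measurePreserving.map_eq]
  exact hf.1

end Stationary

/-! ### Cocycles in duality -/

section Duality

variable {G Y Z : Type*}

/-- The terms of the supremum defining `orbitProduct`. -/
noncomputable def orbitProductTerm (b : G → Y → ℝ) (c : G → Z → ℝ) (y : Y) (z : Z) (h : G) : ℝ :=
  -(b h y + c h z) / 2

/-- The Gromov product of two cocycles, `(y|z) = -(1/2) inf_h (b(h, y) + c(h, z))`. For Busemann
cocycles, this is the Gromov product of horofunctions with the infimum restricted to the orbit of
the base point; the restriction to a countable set makes it measurable. Where the supremum is
infinite, the value is `0`. -/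
noncomputable def orbitProduct (b : G → Y → ℝ) (c : G → Z → ℝ) (y : Y) (z : Z) : ℝ :=
  ⨆ h : G, orbitProductTerm b c y z h

variable {b : G → Y → ℝ} {c : G → Z → ℝ}

theorem measurable_orbitProduct [Countable G] [MeasurableSpace Y] [MeasurableSpace Z]
    (hbm : ∀ g, Measurable (b g)) (hcm : ∀ g, Measurable (c g)) :
    Measurable fun p : Y × Z => orbitProduct b c p.1 p.2 := by
  refine Measurable.iSup fun h => ?_
  have h1 : Measurable fun p : Y × Z => b h p.1 := (hbm h).comp measurable_fst
  have h2 : Measurable fun p : Y × Z => c h p.2 := (hcm h).comp measurable_snd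
  exact (h1.add h2).neg.div_const 2

variable [Group G] [MulAction G Y] [MulAction G Z]

theorem IsCocycle.map_one {b : G → Y → ℝ} (hb : IsCocycle b) (y : Y) : b 1 y = 0 := by
  have := hb 1 1 y
  simp only [mul_one, one_smul] at this
  linarith

theorem IsCocycle.map_inv_smul {b : G → Y → ℝ} (hb : IsCocycle b) (g : G) (y : Y) :
    b g⁻¹ (g • y) = - b g y := by
  have := hb g⁻¹ g y
  rw [inv_mul_cancel, hb.map_one] at this
  linarith

/-- Moving both points by `g` reindexes the terms by `h ↦ h g` and shifts them by a constant. -/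
theorem orbitProductTerm_smul (hb : IsCocycle b) (hc : IsCocycle c) (g h : G) (y : Y) (z : Z) :
    orbitProductTerm b c (g • y) (g • z) h =
      orbitProductTerm b c y z (h * g) + (b g y + c g z) / 2 := by
  have h1 := hb h g y
  have h2 := hc h g z
  simp only [orbitProductTerm]
  linarith

theorem orbitProduct_nonneg (hb : IsCocycle b) (hc : IsCocycle c) (y : Y) (z : Z) :
    0 ≤ orbitProduct b c y z := by
  by_cases hbd : BddAbove (Set.range (orbitProductTerm b c y z))
  · refine le_ciSup_of_le hbd 1 ?_
    simp [orbitProductTerm, hb.map_one, hc.map_one]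
  · rw [orbitProduct, Real.iSup_of_not_bddAbove hbd]

theorem orbitProduct_smul (hb : IsCocycle b) (hc : IsCocycle c) (g : G) {y : Y} {z : Z}
    (hbd : BddAbove (Set.range (orbitProductTerm b c y z))) :
    orbitProduct b c (g • y) (g • z) = orbitProduct b c y z + (b g y + c g z) / 2 := by
  have h1 : BddAbove (Set.range fun h => orbitProductTerm b c y z (h * g)) :=
    hbd.mono (Set.range_comp_subset_range (fun h => h * g) (orbitProductTerm b c y z))
  simp only [orbitProduct, orbitProductTerm_smul hb hc]
  rw [← ciSup_add h1]
  congr 1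
  exact (Equiv.mulRight g).iSup_comp (g := orbitProductTerm b c y z)

/-- The change of the averaged Gromov product `∫ (y|z) dν*(z)` when `y` is moved by `g`. -/
theorem integral_orbitProduct_smul [MeasurableSpace Z] (hb : IsCocycle b) (hc : IsCocycle c)
    (hcm : ∀ g, Measurable (c g)) (hcb : ∀ g, ∃ M, ∀ z, |c g z| ≤ M)
    {νstar : Measure Z} [IsProbabilityMeasure νstar]
    (hfin : ∀ y, ∀ᵐ z ∂νstar, BddAbove (Set.range (orbitProductTerm b c y z)))
    (hint : ∀ y, Integrable (orbitProduct b c y) νstar) (g : G) (y : Y) :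
    ∫ z, orbitProduct b c (g • y) z ∂νstar =
      ∫ z, orbitProduct b c y (g⁻¹ • z) ∂νstar + b g y / 2 - (∫ z, c g⁻¹ z ∂νstar) / 2 := by
  have hci : Integrable (c g⁻¹) νstar := by
    obtain ⟨M, hM⟩ := hcb g⁻¹
    exact Integrable.of_bound (hcm _).aestronglyMeasurable M (Eventually.of_forall hM)
  have hae : (fun z => orbitProduct b c y (g⁻¹ • z)) =ᵐ[νstar]
      fun z => orbitProduct b c (g • y) z - b g y / 2 + c g⁻¹ z / 2 := by
    filter_upwards [hfin (g • y)] with z hz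
    have h1 := orbitProduct_smul hb hc g⁻¹ hz
    rw [inv_smul_smul, hb.map_inv_smul] at h1
    rw [h1]
    ring
  have hi2 : Integrable (fun z => orbitProduct b c (g • y) z - b g y / 2) νstar :=
    (hint _).sub (integrable_const _)
  rw [integral_congr_ae hae, integral_add hi2 (hci.div_const 2),
    integral_sub (hint _) (integrable_const _), integral_div 2 (c g⁻¹), integral_const]
  simp only [probReal_univ, one_smul]
  ring

/-- A cocycle `b` is centerable as soon as its Gromov product with a cocycle `c` over a stationary
space for the reflected walk is uniformly integrable: `-2 ∫ (y|z) dν*(z)` is the correction, and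
the drift is that of `c`. -/
theorem isCenterable_of_orbitProduct [Countable G] [MeasurableSpace G] [DiscreteMeasurableSpace G]
    [MeasurableSpace Y] [MeasurableSpace Z] [MeasurableConstSMul G Y] [MeasurableConstSMul G Z]
    (μ : Measure G) [IsProbabilityMeasure μ]
    (hb : IsCocycle b) (hc : IsCocycle c)
    (hbm : ∀ g, Measurable (b g)) (hcm : ∀ g, Measurable (c g))
    {D : G → ℝ} (hD : Integrable D μ) (hbD : ∀ g y, |b g y| ≤ D g) (hcD : ∀ g z, |c g z| ≤ D g)
    (hDinv : ∀ g, D g⁻¹ = D g)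
    {νstar : Measure Z} [IsProbabilityMeasure νstar] (hνstar : IsStationaryMeasure μ.inv νstar)
    (hfin : ∀ y, ∀ᵐ z ∂νstar, BddAbove (Set.range (orbitProductTerm b c y z)))
    (hint : ∀ y, Integrable (orbitProduct b c y) νstar)
    {M : ℝ} (hM : ∀ y, ∫ z, orbitProduct b c y z ∂νstar ≤ M) :
    IsCenterable μ b (∫ p : G × Z, c p.1 p.2 ∂(μ.inv.prod νstar)) := by
  have hprob : IsProbabilityMeasure μ.inv :=
    Measure.isProbabilityMeasure_map Measurable.of_discrete.aemeasurable
  set φ : Y → ℝ := fun y => ∫ z, orbitProduct b c y z ∂νstar with hφ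
  have hφm : Measurable φ :=
    (StronglyMeasurable.integral_prod_right (f := orbitProduct b c)
      (measurable_orbitProduct hbm hcm).stronglyMeasurable).measurable
  have hφ0 : ∀ y, 0 ≤ φ y := fun y => integral_nonneg fun z => orbitProduct_nonneg hb hc y z
  have hcross := integral_orbitProduct_smul hb hc hcm (fun g => ⟨D g, hcD g⟩) hfin hint
  have hinv : ∀ f : G → ℝ, ∫ g, f g⁻¹ ∂μ = ∫ g, f g ∂μ.inv := fun f =>
    (integral_map Measurable.of_discrete.aemeasurable AEStronglyMeasurable.of_discrete).symm
  have hcint : Integrable (fun g => ∫ z, c g⁻¹ z ∂νstar) μ := by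
    refine hD.mono' AEStronglyMeasurable.of_discrete (Eventually.of_forall fun g => ?_)
    refine (norm_integral_le_of_norm_le_const
      (Eventually.of_forall fun z => hcD g⁻¹ z)).trans ?_
    simp [hDinv]
  have hbint : ∀ y, Integrable (fun g => b g y) μ := fun y =>
    hD.mono' AEStronglyMeasurable.of_discrete (Eventually.of_forall fun g => hbD g y)
  have hφint : ∀ y, Integrable (fun g => φ (g • y)) μ := fun y =>
    integrable_of_forall_norm_le μ (C := M) fun g => by
      rw [Real.norm_of_nonneg (hφ0 _)]; exact hM _
  -- the integrated cocycle `c` over the product space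
  have hcprod : ∫ p : G × Z, c p.1 p.2 ∂(μ.inv.prod νstar) = ∫ g, ∫ z, c g⁻¹ z ∂νstar ∂μ := by
    rw [hinv fun g => ∫ z, c g z ∂νstar, integral_prod]
    have hDi : Integrable D μ.inv :=
      (integrable_map_measure AEStronglyMeasurable.of_discrete
        Measurable.of_discrete.aemeasurable).2 (by simpa [Function.comp_def, hDinv] using hD)
    refine (hDi.comp_fst νstar).mono' ?_ (Eventually.of_forall fun p => hcD p.1 p.2)
    exact (measurable_from_prod_countable_right (f := fun p : G × Z => c p.1 p.2)
      fun g => hcm g).aestronglyMeasurable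
  refine ⟨fun g y => b g y + 2 * φ y - 2 * φ (g • y), fun y => -2 * φ y, ?_, ?_, ?_, ?_, ?_, ?_⟩
  · intro g h y
    simp only [hb g h y, mul_smul]
    ring
  · refine measurable_from_prod_countable_right fun g => ?_
    exact ((hbm g).add (hφm.const_mul 2)).sub ((hφm.comp (measurable_const_smul g)).const_mul 2)
  · intro y
    refine ⟨((hbint y).add (integrable_const _)).sub ((hφint y).const_mul 2), ?_⟩
    rw [hcprod]
    have heq : ∀ g, b g y + 2 * φ y - 2 * φ (g • y) =
        2 * φ y - 2 * ∫ z, orbitProduct b c y (g⁻¹ • z) ∂νstar + ∫ z, c g⁻¹ z ∂νstar := by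
      intro g
      have := hcross g y
      simp only [hφ]
      linarith
    have hstat : ∫ g, ∫ z, orbitProduct b c y (g⁻¹ • z) ∂νstar ∂μ = φ y := by
      rw [hinv fun g => ∫ z, orbitProduct b c y (g • z) ∂νstar]
      exact hνstar.integral_smul (hint y)
    have hKint : Integrable (fun g => ∫ z, orbitProduct b c y (g⁻¹ • z) ∂νstar) μ := by
      have : (fun g => ∫ z, orbitProduct b c y (g⁻¹ • z) ∂νstar) =
          fun g => φ (g • y) - b g y / 2 + (∫ z, c g⁻¹ z ∂νstar) / 2 := by
        ext g
        have := hcross g y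
        simp only [hφ]
        linarith
      rw [this]
      exact ((hφint y).sub ((hbint y).div_const 2)).add (hcint.div_const 2)
    simp_rw [heq]
    have hsub : Integrable (fun g => 2 * φ y - 2 * ∫ z, orbitProduct b c y (g⁻¹ • z) ∂νstar) μ :=
      (integrable_const _).sub (hKint.const_mul 2)
    rw [integral_add hsub hcint,
      integral_sub (integrable_const _) (hKint.const_mul 2),
      integral_const_mul 2 fun g => ∫ z, orbitProduct b c y (g⁻¹ • z) ∂νstar, hstat]
    simp
  · exact hφm.const_mul _
  · refine ⟨2 * M, fun y => ?_⟩
    rw [abs_mul, abs_of_nonneg (hφ0 y)]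
    have := hM y
    norm_num
    exact this
  · intro g y
    ring

end Duality

/-! ### Characteristic functions along a random walk -/

section CharFun

/-- Second order Taylor bound for `exp(i u)`, with an error which is cubic near `0` and quadratic at
infinity, so that it is integrable against a law with finite variance. -/
theorem norm_exp_ofReal_mul_I_sub_taylor_le (u : ℝ) :
    ‖Complex.exp (u * Complex.I) - (1 + u * Complex.I - (u ^ 2 / 2 : ℝ))‖ ≤
      3 * (u ^ 2 * min 1 |u|) := by
  have hI : ‖(u : ℂ) * Complex.I‖ = |u| := by simp
  rcases le_total |u| 1 with h | h
  · rw [min_eq_right h]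
    have h1 := Complex.exp_bound (x := u * Complex.I) (hI.trans_le h) (n := 3) (by norm_num)
    have h2 : ∑ m ∈ Finset.range 3, (u * Complex.I) ^ m / (m.factorial : ℂ) =
        1 + u * Complex.I - (u ^ 2 / 2 : ℝ) := by
      simp [Finset.sum_range_succ, mul_pow, Nat.factorial]
      ring
    rw [h2, hI] at h1
    refine h1.trans ?_
    have : |u| ^ 3 = u ^ 2 * |u| := by rw [pow_succ, sq_abs]
    rw [this]
    have : 0 ≤ u ^ 2 * |u| := by positivity
    norm_num [Nat.factorial]
    linarith
  · rw [min_eq_left h]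
    have h1 : ‖Complex.exp (u * Complex.I) - 1‖ ≤ |u| := by
      have := Real.norm_exp_I_mul_ofReal_sub_one_le (x := u)
      rwa [mul_comm, Real.norm_eq_abs] at this
    have h2 : |u| ≤ u ^ 2 := by
      rw [← sq_abs]; nlinarith [abs_nonneg u]
    have h3 : ‖((u ^ 2 / 2 : ℝ) : ℂ)‖ = u ^ 2 / 2 := by
      rw [Complex.norm_real, Real.norm_of_nonneg (by positivity)]
    have h4 : Complex.exp (u * Complex.I) - (1 + u * Complex.I - (u ^ 2 / 2 : ℝ)) =
        (Complex.exp (u * Complex.I) - 1) - u * Complex.I + (u ^ 2 / 2 : ℝ) := by ring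
    rw [h4]
    refine (norm_add_le _ _).trans ?_
    have := norm_sub_le (Complex.exp (u * Complex.I) - 1) (u * Complex.I)
    rw [h3]
    nlinarith

theorem abs_one_sub_sub_exp_neg_le {z : ℝ} (hz : 0 ≤ z) : |1 - z - Real.exp (-z)| ≤ z ^ 2 := by
  have h1 : 1 - z ≤ Real.exp (-z) := by linarith [Real.add_one_le_exp (-z)]
  have h2 : Real.exp (-z) * (1 + z) ≤ 1 := by
    have h3 : 1 + z ≤ Real.exp z := by linarith [Real.add_one_le_exp z]
    calc Real.exp (-z) * (1 + z) ≤ Real.exp (-z) * Real.exp z := by gcongr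
      _ = 1 := by rw [← Real.exp_add]; simp
  rw [abs_sub_comm, abs_of_nonneg (by linarith)]
  nlinarith [pow_nonneg hz 3]

variable {G : Type*} [Group G] [MeasurableSpace G] {Y : Type*} [MulAction G Y]

/-- The transfer operator `f ↦ ∫ exp(i s ξ(a, y)) f(a y) dμ(a)`, a perturbation of the Markov
operator of the walk by the increments `ξ` of an additive functional. -/
noncomputable def transferOp (μ : Measure G) (ξ : G → Y → ℝ) (s : ℝ) (f : Y → ℂ) (y : Y) : ℂ :=
  ∫ a, Complex.exp ((s * ξ a y : ℝ) * Complex.I) * f (a • y) ∂μ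

/-- The expectation of `exp(i s (β(g, x) - k c)) f(g x)`, where `g` is the position of the random
walk at time `k`. -/
noncomputable def twistedExpectation (μ : Measure G) (β : G → Y → ℝ) (c s : ℝ) (x : Y) (k : ℕ)
    (f : Y → ℂ) : ℂ :=
  ∫ g, Complex.exp ((s * (β g x - k * c) : ℝ) * Complex.I) * f (g • x) ∂(convPow μ k)

variable {μ : Measure G} {β : G → Y → ℝ} {c s : ℝ} {x : Y}

theorem twistedExpectation_const_mul (k : ℕ) (a : ℂ) (f : Y → ℂ) :
    twistedExpectation μ β c s x k (fun y => a * f y) =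
      a * twistedExpectation μ β c s x k f := by
  simp only [twistedExpectation, ← integral_const_mul]
  refine integral_congr_ae (Eventually.of_forall fun g => ?_)
  simp only
  ring

variable [Countable G] [DiscreteMeasurableSpace G]

theorem twistedExpectation_zero (hβ : IsCocycle β) (f : Y → ℂ) :
    twistedExpectation μ β c s x 0 f = f x := by
  simp only [twistedExpectation]
  change ∫ g, _ ∂(Measure.dirac (1 : G)) = _
  rw [integral_dirac]
  simp [hβ.map_one]

variable [IsProbabilityMeasure μ]

/-- The Markov property: one step of the walk acts by the transfer operator. -/
theorem twistedExpectation_succ (hβ : IsCocycle β) (k : ℕ) {f : Y → ℂ} {C : ℝ}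
    (hf : ∀ y, ‖f y‖ ≤ C) :
    twistedExpectation μ β c s x (k + 1) f =
      twistedExpectation μ β c s x k (transferOp μ (fun a y => β a y - c) s f) := by
  refine (integral_convPow_succ μ k (C := C) fun g => ?_).trans ?_
  · rw [norm_mul, Complex.norm_exp_ofReal_mul_I, one_mul]
    exact hf _
  · simp only [twistedExpectation, transferOp]
    refine integral_congr_ae (Eventually.of_forall fun b => ?_)
    simp only
    rw [← integral_const_mul]
    refine integral_congr_ae (Eventually.of_forall fun a => ?_)
    simp only [hβ a b x, mul_smul]
    rw [← mul_assoc, ← Complex.exp_add]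
    congr 2
    push_cast
    ring

theorem norm_twistedExpectation_le (k : ℕ) {f : Y → ℂ} {r : Y → ℝ} {C : ℝ}
    (hf : ∀ y, ‖f y‖ ≤ r y) (hr : ∀ y, r y ≤ C) :
    ‖twistedExpectation μ β c s x k f‖ ≤ ∫ g, r (g • x) ∂(convPow μ k) := by
  refine norm_integral_le_of_norm_le (integrable_of_forall_norm_le _ (C := C) fun g => ?_)
    (Eventually.of_forall fun g => ?_)
  · rw [Real.norm_of_nonneg ((norm_nonneg _).trans (hf _))]
    exact hr _
  · rw [norm_mul, Complex.norm_exp_ofReal_mul_I, one_mul]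
    exact hf _

theorem integrable_twisted (k : ℕ) {f : Y → ℂ} {C : ℝ} (hf : ∀ y, ‖f y‖ ≤ C) :
    Integrable (fun g => Complex.exp ((s * (β g x - k * c) : ℝ) * Complex.I) * f (g • x))
      (convPow μ k) :=
  integrable_of_forall_norm_le _ (C := C) fun g => by
    rw [norm_mul, Complex.norm_exp_ofReal_mul_I, one_mul]
    exact hf _

theorem twistedExpectation_sub (k : ℕ) {f f' : Y → ℂ} {C C' : ℝ} (hf : ∀ y, ‖f y‖ ≤ C)
    (hf' : ∀ y, ‖f' y‖ ≤ C') :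
    twistedExpectation μ β c s x k (fun y => f y - f' y) =
      twistedExpectation μ β c s x k f - twistedExpectation μ β c s x k f' := by
  rw [twistedExpectation, twistedExpectation, twistedExpectation,
    ← integral_sub (integrable_twisted k hf) (integrable_twisted k hf')]
  simp only [mul_sub]

variable {ξ : G → Y → ℝ} {D : G → ℝ}

/-- Second order expansion of the transfer operator at the constant function `1`. The error is
`o(s²)`, uniformly in `y`. -/
theorem norm_transferOp_one_sub_le (hD2 : Integrable (fun a => D a ^ 2) μ)
    (hξD : ∀ a y, |ξ a y| ≤ D a) (s : ℝ) (y : Y) (h0 : Integrable (fun a => ξ a y) μ)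
    (hmean : ∫ a, ξ a y ∂μ = 0) :
    ‖transferOp μ ξ s (fun _ => 1) y - (1 - (s ^ 2 / 2 * ∫ a, ξ a y ^ 2 ∂μ : ℝ))‖ ≤
      3 * s ^ 2 * ∫ a, D a ^ 2 * min 1 (|s| * D a) ∂μ := by
  have hD0 : ∀ a, 0 ≤ D a := fun a => (abs_nonneg _).trans (hξD a y)
  have hsq : Integrable (fun a => ξ a y ^ 2) μ := by
    refine hD2.mono' AEStronglyMeasurable.of_discrete (Eventually.of_forall fun a => ?_)
    rw [Real.norm_of_nonneg (sq_nonneg _)]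
    exact sq_le_sq' (by linarith [neg_abs_le (ξ a y), hξD a y]) ((le_abs_self _).trans (hξD a y))
  have hexp : Integrable (fun a => Complex.exp ((s * ξ a y : ℝ) * Complex.I)) μ :=
    integrable_of_forall_norm_le _ (C := 1) fun a => by rw [Complex.norm_exp_ofReal_mul_I]
  have hlin : Integrable (fun a => ((s * ξ a y : ℝ) : ℂ) * Complex.I) μ :=
    ((h0.const_mul s).ofReal).mul_const _
  have hquad : Integrable (fun a => (((s * ξ a y) ^ 2 / 2 : ℝ) : ℂ)) μ := by
    have : Integrable (fun a => (s * ξ a y) ^ 2 / 2) μ := by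
      simp_rw [mul_pow]
      exact (hsq.const_mul _).div_const _
    exact this.ofReal
  have h1lin : Integrable (fun a => 1 + ((s * ξ a y : ℝ) : ℂ) * Complex.I) μ :=
    (integrable_const _).add hlin
  have h1quad : Integrable (fun a => 1 + ((s * ξ a y : ℝ) : ℂ) * Complex.I -
      (((s * ξ a y) ^ 2 / 2 : ℝ) : ℂ)) μ := h1lin.sub hquad
  have key : transferOp μ ξ s (fun _ => 1) y - (1 - (s ^ 2 / 2 * ∫ a, ξ a y ^ 2 ∂μ : ℝ)) =
      ∫ a, (Complex.exp ((s * ξ a y : ℝ) * Complex.I) -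
        (1 + (s * ξ a y : ℝ) * Complex.I - ((s * ξ a y) ^ 2 / 2 : ℝ))) ∂μ := by
    rw [integral_sub hexp h1quad, integral_sub h1lin hquad,
      integral_add (integrable_const _) hlin, integral_mul_const, integral_complex_ofReal,
      integral_complex_ofReal, integral_const_mul, hmean]
    simp only [mul_pow, transferOp, mul_one, integral_div, integral_const_mul]
    simp
    ring
  rw [key, ← integral_const_mul]
  refine norm_integral_le_of_norm_le ?_ (Eventually.of_forall fun a => ?_)
  · refine Integrable.const_mul ?_ _
    refine hD2.mono' AEStronglyMeasurable.of_discrete (Eventually.of_forall fun a => ?_)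
    have : 0 ≤ min 1 (|s| * D a) := le_min zero_le_one (mul_nonneg (abs_nonneg s) (hD0 a))
    rw [Real.norm_of_nonneg (mul_nonneg (sq_nonneg _) this)]
    exact mul_le_of_le_one_right (sq_nonneg _) (min_le_left _ _)
  · refine (norm_exp_ofReal_mul_I_sub_taylor_le _).trans ?_
    rw [abs_mul, mul_pow]
    have h1 : ξ a y ^ 2 ≤ D a ^ 2 :=
      sq_le_sq' (by linarith [neg_abs_le (ξ a y), hξD a y]) ((le_abs_self _).trans (hξD a y))
    have h2 : min 1 (|s| * |ξ a y|) ≤ min 1 (|s| * D a) :=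
      min_le_min le_rfl (mul_le_mul_of_nonneg_left (hξD a y) (abs_nonneg s))
    have h3 : 0 ≤ min 1 (|s| * |ξ a y|) := le_min zero_le_one (by positivity)
    calc 3 * (s ^ 2 * ξ a y ^ 2 * min 1 (|s| * |ξ a y|))
        ≤ 3 * (s ^ 2 * D a ^ 2 * min 1 (|s| * D a)) := by gcongr
      _ = _ := by ring

/-- The transfer operator is a perturbation of size `O(|s|)` of the Markov operator. -/
theorem norm_transferOp_sub_le (hD : Integrable D μ) (hξD : ∀ a y, |ξ a y| ≤ D a) (s : ℝ) (y : Y)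
    {U : Y → ℝ} {B : ℝ} (hU : ∀ y, |U y| ≤ B) :
    ‖transferOp μ ξ s (fun y => (U y : ℂ)) y - (∫ a, U (a • y) ∂μ : ℝ)‖ ≤
      |s| * B * ∫ a, D a ∂μ := by
  have hUn : ∀ y, ‖(U y : ℂ)‖ ≤ B := fun y => by
    rw [Complex.norm_real]; exact hU y
  have hB : 0 ≤ B := (abs_nonneg _).trans (hU y)
  rw [← integral_complex_ofReal, transferOp, ← integral_sub, ← integral_const_mul]
  · refine norm_integral_le_of_norm_le (hD.const_mul _) (Eventually.of_forall fun a => ?_)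
    rw [← sub_one_mul, norm_mul]
    have h1 : ‖Complex.exp ((s * ξ a y : ℝ) * Complex.I) - 1‖ ≤ |s| * D a := by
      have := Real.norm_exp_I_mul_ofReal_sub_one_le (x := s * ξ a y)
      rw [mul_comm, Real.norm_eq_abs, abs_mul] at this
      exact this.trans (mul_le_mul_of_nonneg_left (hξD a y) (abs_nonneg s))
    calc _ ≤ |s| * D a * B := mul_le_mul h1 (hUn _) (norm_nonneg _) ((norm_nonneg _).trans h1)
      _ = _ := by ring
  · refine integrable_of_forall_norm_le _ (C := B) fun a => ?_
    rw [norm_mul, Complex.norm_exp_ofReal_mul_I, one_mul]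
    exact hUn _
  · exact integrable_of_forall_norm_le _ (C := B) fun a => hUn _

/-- Quantitative form of the central limit theorem: if the conditional variance of the increments
is `v` up to a coboundary `U - P U` and a remainder `R`, the characteristic function of the walk at
time `n` is close to that of a Gaussian variable of variance `n v`. The corrector
`1 - (s² / 2) U` absorbs the coboundary. -/
theorem norm_twistedExpectation_one_sub_le (hβ : IsCocycle β)
    (hD : Integrable D μ) (hD2 : Integrable (fun a => D a ^ 2) μ)
    (hξD : ∀ a y, |β a y - c| ≤ D a) (hmean : ∀ y, ∫ a, (β a y - c) ∂μ = 0)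
    {v : ℝ} (hv : 0 ≤ v) {U R : Y → ℝ} {B B' : ℝ} (hU : ∀ y, |U y| ≤ B) (hR : ∀ y, |R y| ≤ B')
    (hdec : ∀ y, ∫ a, (β a y - c) ^ 2 ∂μ - v = U y - ∫ a, U (a • y) ∂μ + R y)
    (x : Y) (s : ℝ) (n : ℕ) :
    ‖twistedExpectation μ β c s x n (fun _ => 1) - (Real.exp (-(s ^ 2 * v / 2)) : ℂ) ^ n‖ ≤
      n * (s ^ 2 * (s ^ 2 * (v ^ 2 + B * v) / 4 + 3 * ∫ a, D a ^ 2 * min 1 (|s| * D a) ∂μ +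
        |s| * B * (∫ a, D a ∂μ) / 2)) +
      s ^ 2 / 2 * ∑ k ∈ Finset.range n, ∫ g, |R (g • x)| ∂(convPow μ k) + s ^ 2 * B := by
  have hB : 0 ≤ B := (abs_nonneg _).trans (hU x)
  set q : ℝ := Real.exp (-(s ^ 2 * v / 2)) with hq
  have hz : 0 ≤ s ^ 2 * v / 2 := by positivity
  have hq1 : q ≤ 1 := Real.exp_le_one_iff.2 (by linarith)
  have hq0 : 0 ≤ q := (Real.exp_pos _).le
  have hqz : |1 - q| ≤ s ^ 2 * v / 2 := by
    rw [abs_of_nonneg (by linarith)]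
    linarith [Real.add_one_le_exp (-(s ^ 2 * v / 2))]
  set κ : ℝ := s ^ 2 * (s ^ 2 * (v ^ 2 + B * v) / 4 +
    3 * ∫ a, D a ^ 2 * min 1 (|s| * D a) ∂μ + |s| * B * (∫ a, D a ∂μ) / 2) with hκ
  set ξ : G → Y → ℝ := fun a y => β a y - c with hξ
  set f : Y → ℂ := fun y => 1 - ((s ^ 2 / 2 * U y : ℝ) : ℂ) with hf
  have hfU : ∀ y, ‖((s ^ 2 / 2 * U y : ℝ) : ℂ)‖ ≤ s ^ 2 / 2 * B := fun y => by
    rw [Complex.norm_real, norm_mul, Real.norm_of_nonneg (by positivity)]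
    exact mul_le_mul_of_nonneg_left (hU y) (by positivity)
  have hfb : ∀ y, ‖f y‖ ≤ 1 + s ^ 2 / 2 * B := fun y =>
    (norm_sub_le _ _).trans (by rw [norm_one]; linarith [hfU y])
  have hint : ∀ y, Integrable (fun a => ξ a y) μ := fun y =>
    hD.mono' AEStronglyMeasurable.of_discrete (Eventually.of_forall fun a => hξD a y)
  -- the transfer operator acts on the corrected function almost as multiplication by `q`
  have hQf : ∀ y, ‖transferOp μ ξ s f y - q * f y‖ ≤ κ + s ^ 2 / 2 * |R y| := by
    intro y
    have hsplit : transferOp μ ξ s f y = transferOp μ ξ s (fun _ => 1) y -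
        ((s ^ 2 / 2 : ℝ) : ℂ) * transferOp μ ξ s (fun y => (U y : ℂ)) y := by
      simp only [transferOp, ← integral_const_mul]
      rw [← integral_sub]
      · refine integral_congr_ae (Eventually.of_forall fun a => ?_)
        simp only [hf]
        push_cast
        ring
      · refine integrable_of_forall_norm_le _ (C := 1) fun a => ?_
        rw [mul_one, Complex.norm_exp_ofReal_mul_I]
      · refine (integrable_of_forall_norm_le _ (C := B) fun a => ?_).const_mul _
        rw [norm_mul, Complex.norm_exp_ofReal_mul_I, one_mul, Complex.norm_real]
        exact hU _
    have e1 := norm_transferOp_one_sub_le hD2 hξD s y (hint y) (hmean y)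
    have e2 := norm_transferOp_sub_le hD hξD s y hU
    have e3 := abs_one_sub_sub_exp_neg_le hz
    have hV : ∫ a, ξ a y ^ 2 ∂μ = v + U y - ∫ a, U (a • y) ∂μ + R y := by
      linarith [hdec y]
    set A := transferOp μ ξ s (fun _ => 1) y
    set A' := transferOp μ ξ s (fun y => (U y : ℂ)) y
    set p := ∫ a, U (a • y) ∂μ
    have hid : transferOp μ ξ s f y - q * f y =
        (A - (1 - (s ^ 2 / 2 * ∫ a, ξ a y ^ 2 ∂μ : ℝ))) - ((s ^ 2 / 2 : ℝ) : ℂ) * (A' - (p : ℝ)) +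
        ((1 - s ^ 2 * v / 2 - q : ℝ) : ℂ) - ((s ^ 2 / 2 * U y * (1 - q) : ℝ) : ℂ) -
        ((s ^ 2 / 2 * R y : ℝ) : ℂ) := by
      rw [hsplit, hV]
      simp only [hf]
      push_cast
      ring
    rw [hid]
    have n2 : ‖((s ^ 2 / 2 : ℝ) : ℂ) * (A' - (p : ℝ))‖ ≤
        s ^ 2 / 2 * (|s| * B * ∫ a, D a ∂μ) := by
      rw [norm_mul, Complex.norm_real, Real.norm_of_nonneg (by positivity)]
      exact mul_le_mul_of_nonneg_left e2 (by positivity)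
    have n3 : ‖((1 - s ^ 2 * v / 2 - q : ℝ) : ℂ)‖ ≤ (s ^ 2 * v / 2) ^ 2 := by
      rw [Complex.norm_real]; exact e3
    have n4 : ‖((s ^ 2 / 2 * U y * (1 - q) : ℝ) : ℂ)‖ ≤ s ^ 2 / 2 * B * (s ^ 2 * v / 2) := by
      rw [Complex.norm_real, norm_mul, norm_mul, Real.norm_of_nonneg (by positivity)]
      have := hU y
      simp only [Real.norm_eq_abs]
      gcongr
    have n5 : ‖((s ^ 2 / 2 * R y : ℝ) : ℂ)‖ = s ^ 2 / 2 * |R y| := by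
      rw [Complex.norm_real, norm_mul, Real.norm_of_nonneg (by positivity), Real.norm_eq_abs]
    refine (norm_sub_le _ _).trans ?_
    rw [n5]
    have := norm_sub_le ((A - (1 - (s ^ 2 / 2 * ∫ a, ξ a y ^ 2 ∂μ : ℝ))) -
      ((s ^ 2 / 2 : ℝ) : ℂ) * (A' - (p : ℝ)) + ((1 - s ^ 2 * v / 2 - q : ℝ) : ℂ))
      ((s ^ 2 / 2 * U y * (1 - q) : ℝ) : ℂ)
    have := norm_add_le ((A - (1 - (s ^ 2 / 2 * ∫ a, ξ a y ^ 2 ∂μ : ℝ))) -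
      ((s ^ 2 / 2 : ℝ) : ℂ) * (A' - (p : ℝ))) ((1 - s ^ 2 * v / 2 - q : ℝ) : ℂ)
    have := norm_sub_le (A - (1 - (s ^ 2 / 2 * ∫ a, ξ a y ^ 2 ∂μ : ℝ)))
      (((s ^ 2 / 2 : ℝ) : ℂ) * (A' - (p : ℝ)))
    have hκ' : κ = 3 * s ^ 2 * (∫ a, D a ^ 2 * min 1 (|s| * D a) ∂μ) +
      s ^ 2 / 2 * (|s| * B * ∫ a, D a ∂μ) + (s ^ 2 * v / 2) ^ 2 +
      s ^ 2 / 2 * B * (s ^ 2 * v / 2) := by rw [hκ]; ring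
    linarith
  set d : ℕ → ℂ := fun k => twistedExpectation μ β c s x k f with hd
  have hstep : ∀ k, ‖d (k + 1) - q * d k‖ ≤
      κ + s ^ 2 / 2 * ∫ g, |R (g • x)| ∂(convPow μ k) := by
    intro k
    have hQb : ∀ y, ‖transferOp μ ξ s f y‖ ≤ 1 + s ^ 2 / 2 * B := by
      intro y
      refine (norm_integral_le_of_norm_le_const (C := 1 + s ^ 2 / 2 * B)
        (Eventually.of_forall fun a => ?_)).trans (by simp)
      rw [norm_mul, Complex.norm_exp_ofReal_mul_I, one_mul]
      exact hfb _
    have hqf : ∀ y, ‖(q : ℂ) * f y‖ ≤ q * (1 + s ^ 2 / 2 * B) := fun y => by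
      rw [norm_mul, Complex.norm_real, Real.norm_of_nonneg hq0]
      exact mul_le_mul_of_nonneg_left (hfb y) hq0
    have hdk : d (k + 1) - q * d k =
        twistedExpectation μ β c s x k (fun y => transferOp μ ξ s f y - q * f y) := by
      rw [twistedExpectation_sub k hQb hqf, twistedExpectation_const_mul, hd]
      simp only
      rw [twistedExpectation_succ hβ k hfb]
    rw [hdk]
    refine (norm_twistedExpectation_le k (r := fun y => κ + s ^ 2 / 2 * |R y|)
      (C := κ + s ^ 2 / 2 * B') hQf fun y => ?_).trans ?_
    · have := hR y
      gcongr
    · have hRi : Integrable (fun g => |R (g • x)|) (convPow μ k) :=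
        integrable_of_forall_norm_le _ (C := B') fun g => by
          rw [Real.norm_eq_abs, abs_abs]; exact hR _
      rw [integral_add (integrable_const _) (hRi.const_mul _),
        integral_const_mul _ fun g => |R (g • x)|]
      simp
  have hiter : ∀ m : ℕ, ‖d m - (q : ℂ) ^ m * d 0‖ ≤
      m * κ + s ^ 2 / 2 * ∑ k ∈ Finset.range m, ∫ g, |R (g • x)| ∂(convPow μ k) := by
    intro m
    induction m with
    | zero => simp
    | succ m ih =>
      have h1 : d (m + 1) - (q : ℂ) ^ (m + 1) * d 0 =
          (d (m + 1) - q * d m) + q * (d m - (q : ℂ) ^ m * d 0) := by ring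
      rw [h1, Finset.sum_range_succ]
      refine (norm_add_le _ _).trans ?_
      have h2 : ‖(q : ℂ) * (d m - (q : ℂ) ^ m * d 0)‖ ≤ ‖d m - (q : ℂ) ^ m * d 0‖ := by
        rw [norm_mul, Complex.norm_real, Real.norm_of_nonneg hq0]
        exact mul_le_of_le_one_left (norm_nonneg _) hq1
      have := hstep m
      push_cast
      linarith
  have hd0 : d 0 = f x := twistedExpectation_zero hβ f
  have hlast : ‖twistedExpectation μ β c s x n (fun _ => 1) - d n‖ ≤ s ^ 2 / 2 * B := by
    rw [hd]
    simp only
    rw [← twistedExpectation_sub n (C := 1) (fun y => by simp) hfb]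
    refine (norm_twistedExpectation_le n (r := fun _ => s ^ 2 / 2 * B) (C := s ^ 2 / 2 * B)
      (fun y => ?_) fun y => le_rfl).trans (by simp)
    simpa [hf] using hfU y
  have hfirst : ‖(q : ℂ) ^ n * d 0 - (q : ℂ) ^ n‖ ≤ s ^ 2 / 2 * B := by
    rw [hd0, ← mul_sub_one, norm_mul, norm_pow, Complex.norm_real, Real.norm_of_nonneg hq0]
    have h1 : ‖f x - 1‖ ≤ s ^ 2 / 2 * B := by
      have : f x - 1 = -((s ^ 2 / 2 * U x : ℝ) : ℂ) := by simp [hf]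
      rw [this, norm_neg]
      exact hfU x
    exact (mul_le_of_le_one_left (norm_nonneg _) (pow_le_one₀ hq0 hq1)).trans h1
  have htri : twistedExpectation μ β c s x n (fun _ => 1) - (q : ℂ) ^ n =
      (twistedExpectation μ β c s x n (fun _ => 1) - d n) + (d n - (q : ℂ) ^ n * d 0) +
        ((q : ℂ) ^ n * d 0 - (q : ℂ) ^ n) := by ring
  rw [htri]
  refine (norm_add₃_le).trans ?_
  have := hiter n
  linarith

end CharFun

/-! ### The central limit theorem at a point -/

section PointwiseCLT

theorem tendsto_integral_sq_mul_min {G : Type*} [Countable G] [MeasurableSpace G]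
    [DiscreteMeasurableSpace G] {μ : Measure G} {D : G → ℝ} (hD0 : ∀ a, 0 ≤ D a)
    (hD2 : Integrable (fun a => D a ^ 2) μ) :
    Tendsto (fun s : ℝ => ∫ a, D a ^ 2 * min 1 (|s| * D a) ∂μ) (𝓝 0) (𝓝 0) := by
  have h : Tendsto (fun s : ℝ => ∫ a, D a ^ 2 * min 1 (|s| * D a) ∂μ) (𝓝 0)
      (𝓝 (∫ _, (0 : ℝ) ∂μ)) := by
    refine tendsto_integral_filter_of_dominated_convergence (fun a => D a ^ 2)
      (Eventually.of_forall fun s => AEStronglyMeasurable.of_discrete)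
      (Eventually.of_forall fun s => Eventually.of_forall fun a => ?_) hD2
      (Eventually.of_forall fun a => ?_)
    · have : 0 ≤ min 1 (|s| * D a) := le_min zero_le_one (mul_nonneg (abs_nonneg s) (hD0 a))
      rw [Real.norm_of_nonneg (mul_nonneg (sq_nonneg _) this)]
      exact mul_le_of_le_one_right (sq_nonneg _) (min_le_left _ _)
    · have hc : Continuous fun s : ℝ => D a ^ 2 * min 1 (|s| * D a) := by fun_prop
      simpa using hc.tendsto 0
  simpa using h

variable {G : Type*} [Group G] [MeasurableSpace G] {Y : Type*} [MulAction G Y]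

/-- Along the random walk started at `x`, the function `W` is, up to a remainder whose time
averages are arbitrarily small in mean, a bounded coboundary `U - P U` of the Markov operator
`P U(y) = ∫ U(a y) dμ(a)`. -/
def IsAlmostCoboundaryAt (μ : Measure G) (W : Y → ℝ) (x : Y) : Prop :=
  ∀ ε : ℝ, 0 < ε → ∃ (U R : Y → ℝ) (B B' : ℝ), (∀ y, |U y| ≤ B) ∧ (∀ y, |R y| ≤ B') ∧
    (∀ y, W y = U y - ∫ a, U (a • y) ∂μ + R y) ∧
    ∀ n : ℕ, ∑ k ∈ Finset.range n, ∫ g, |R (g • x)| ∂(convPow μ k) ≤ ε * n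

variable [Countable G] [DiscreteMeasurableSpace G] {μ : Measure G} [IsProbabilityMeasure μ]
  {β : G → Y → ℝ} {c v : ℝ} {x : Y} {D : G → ℝ}

theorem tendsto_twistedExpectation_one (hβ : IsCocycle β)
    (hD : Integrable D μ) (hD2 : Integrable (fun a => D a ^ 2) μ)
    (hξD : ∀ a y, |β a y - c| ≤ D a) (hmean : ∀ y, ∫ a, (β a y - c) ∂μ = 0) (hv : 0 ≤ v)
    (hW : IsAlmostCoboundaryAt μ (fun y => ∫ a, (β a y - c) ^ 2 ∂μ - v) x) (t : ℝ) :
    Tendsto (fun n : ℕ => twistedExpectation μ β c (t / √n) x n fun _ => 1) atTop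
      (𝓝 (Real.exp (-(t ^ 2 * v / 2)) : ℂ)) := by
  have hD0 : ∀ a, 0 ≤ D a := fun a => (abs_nonneg _).trans (hξD a x)
  rw [tendsto_iff_norm_sub_tendsto_zero, Metric.tendsto_atTop]
  intro δ hδ
  obtain ⟨U, R, B, B', hU, hR, hdec, hRn⟩ := hW (δ / (t ^ 2 + 1)) (by positivity)
  have hs : Tendsto (fun n : ℕ => t / √(n : ℝ)) atTop (𝓝 0) :=
    tendsto_const_nhds.div_atTop (Real.tendsto_sqrt_atTop.comp tendsto_natCast_atTop_atTop)
  have hη := (tendsto_integral_sq_mul_min hD0 hD2).comp hs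
  have hs2 : Tendsto (fun n : ℕ => (t / √(n : ℝ)) ^ 2) atTop (𝓝 0) := by simpa using hs.pow 2
  have habs : Tendsto (fun n : ℕ => |t / √(n : ℝ)|) atTop (𝓝 0) := by simpa using hs.abs
  have hlim : Tendsto (fun n : ℕ => t ^ 2 * ((t / √(n : ℝ)) ^ 2 * (v ^ 2 + B * v) / 4 +
      3 * (∫ a, D a ^ 2 * min 1 (|t / √(n : ℝ)| * D a) ∂μ) +
      |t / √(n : ℝ)| * B * (∫ a, D a ∂μ) / 2) + (t ^ 2 / 2 * (δ / (t ^ 2 + 1)) +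
      (t / √(n : ℝ)) ^ 2 * B)) atTop
      (𝓝 (t ^ 2 * (0 * (v ^ 2 + B * v) / 4 + 3 * 0 + 0 * B * (∫ a, D a ∂μ) / 2) +
        (t ^ 2 / 2 * (δ / (t ^ 2 + 1)) + 0 * B))) :=
    ((((hs2.mul_const _).div_const _).add (hη.const_mul 3)).add
      (((habs.mul_const B).mul_const _).div_const 2)).const_mul _ |>.add
      ((hs2.mul_const B).const_add _)
  have hsmall : t ^ 2 * (0 * (v ^ 2 + B * v) / 4 + 3 * 0 + 0 * B * (∫ a, D a ∂μ) / 2) +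
      (t ^ 2 / 2 * (δ / (t ^ 2 + 1)) + 0 * B) < δ := by
    have h1 : t ^ 2 / 2 * (δ / (t ^ 2 + 1)) < δ := by
      rw [← mul_div_assoc, div_lt_iff₀ (by positivity)]
      nlinarith [mul_nonneg hδ.le (sq_nonneg t)]
    simpa using h1
  obtain ⟨N, hN⟩ := eventually_atTop.1 (hlim.eventually_lt_const hsmall)
  refine ⟨max N 1, fun n hn => ?_⟩
  have hn1 : 1 ≤ n := (le_max_right _ _).trans hn
  have hn0 : (0 : ℝ) < n := by exact_mod_cast hn1
  have hns : (n : ℝ) * (t / √(n : ℝ)) ^ 2 = t ^ 2 := by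
    rw [div_pow, Real.sq_sqrt hn0.le]
    field_simp
  have key := norm_twistedExpectation_one_sub_le hβ hD hD2 hξD hmean hv hU hR hdec x
    (t / √(n : ℝ)) n
  have hpow : (Real.exp (-((t / √(n : ℝ)) ^ 2 * v / 2)) : ℂ) ^ n =
      (Real.exp (-(t ^ 2 * v / 2)) : ℂ) := by
    rw [← Complex.ofReal_pow, ← Real.exp_nat_mul, ← hns]
    congr 2
    ring
  rw [hpow] at key
  rw [Real.dist_eq, sub_zero, abs_norm]
  refine lt_of_le_of_lt key (lt_of_le_of_lt ?_ (hN n ((le_max_left _ _).trans hn)))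
  have h2 : (t / √(n : ℝ)) ^ 2 / 2 * ∑ k ∈ Finset.range n, ∫ g, |R (g • x)| ∂(convPow μ k) ≤
      t ^ 2 / 2 * (δ / (t ^ 2 + 1)) := by
    calc _ ≤ (t / √(n : ℝ)) ^ 2 / 2 * (δ / (t ^ 2 + 1) * n) :=
          mul_le_mul_of_nonneg_left (hRn n) (by positivity)
      _ = (n * (t / √(n : ℝ)) ^ 2) / 2 * (δ / (t ^ 2 + 1)) := by ring
      _ = _ := by rw [hns]
  rw [← mul_assoc, hns]
  linarith

/-- The central limit theorem for the random walk started at `x`, for a function `σ` at bounded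
distance from a cocycle with constant drift, when the conditional variance of the increments is an
almost coboundary up to the constant `v`. -/
theorem tendsto_integral_convPow_gaussianReal (hβ : IsCocycle β)
    (hD : Integrable D μ) (hD2 : Integrable (fun a => D a ^ 2) μ)
    (hξD : ∀ a y, |β a y - c| ≤ D a) (hmean : ∀ y, ∫ a, (β a y - c) ∂μ = 0) (hv : 0 ≤ v)
    (hW : IsAlmostCoboundaryAt μ (fun y => ∫ a, (β a y - c) ^ 2 ∂μ - v) x)
    {σ : G → ℝ} {M : ℝ} (hσ : ∀ g, |σ g - β g x| ≤ M)
    {F : ℝ → ℝ} (hF : Continuous F) (hFb : ∃ C, ∀ t, |F t| ≤ C) :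
    Tendsto (fun n : ℕ => ∫ g, F ((σ g - n * c) / √n) ∂(convPow μ n)) atTop
      (𝓝 (∫ t, F t ∂(gaussianReal 0 v.toNNReal))) := by
  have hmeas : ∀ n : ℕ, AEMeasurable (fun g => (σ g - n * c) / √(n : ℝ)) (convPow μ n) :=
    fun n => Measurable.of_discrete.aemeasurable
  set law : ℕ → ProbabilityMeasure ℝ := fun n =>
    ⟨(convPow μ n).map fun g => (σ g - n * c) / √(n : ℝ),
      Measure.isProbabilityMeasure_map (hmeas n)⟩ with hlaw
  set gauss : ProbabilityMeasure ℝ := ⟨gaussianReal 0 v.toNNReal, inferInstance⟩ with hgauss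
  have hconv : Tendsto law atTop (𝓝 gauss) := by
    refine ProbabilityMeasure.tendsto_of_tendsto_charFun fun t => ?_
    have hG : charFun (gauss : Measure ℝ) t = (Real.exp (-(t ^ 2 * v / 2)) : ℂ) := by
      simp only [hgauss, ProbabilityMeasure.coe_mk, charFun_gaussianReal]
      push_cast [Real.coe_toNNReal v hv]
      congr 1
      ring
    have hL : ∀ n, charFun (law n : Measure ℝ) t =
        ∫ g, Complex.exp ((t / √(n : ℝ) * (σ g - n * c) : ℝ) * Complex.I) ∂(convPow μ n) := by
      intro n
      simp only [hlaw, ProbabilityMeasure.coe_mk]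
      rw [charFun_apply_real, integral_map (hmeas n) (by fun_prop)]
      refine integral_congr_ae (Eventually.of_forall fun g => ?_)
      simp only
      congr 2
      push_cast
      ring
    rw [hG]
    simp_rw [hL]
    have h1 := tendsto_twistedExpectation_one hβ hD hD2 hξD hmean hv hW t
    -- replacing `β` by `σ` changes the characteristic function by `O(1 / √n)`
    have h2 : Tendsto (fun n : ℕ => (∫ g, Complex.exp ((t / √(n : ℝ) * (σ g - n * c) : ℝ) *
        Complex.I) ∂(convPow μ n)) - twistedExpectation μ β c (t / √n) x n fun _ => 1) atTop
        (𝓝 0) := by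
      have hs : Tendsto (fun n : ℕ => |t / √(n : ℝ)| * M) atTop (𝓝 0) := by
        have : Tendsto (fun n : ℕ => t / √(n : ℝ)) atTop (𝓝 0) :=
          tendsto_const_nhds.div_atTop
            (Real.tendsto_sqrt_atTop.comp tendsto_natCast_atTop_atTop)
        simpa using this.abs.mul_const M
      refine squeeze_zero_norm (fun n => ?_) hs
      simp only [twistedExpectation, mul_one]
      rw [← integral_sub]
      · refine (norm_integral_le_of_norm_le_const (C := |t / √(n : ℝ)| * M)
          (Eventually.of_forall fun g => ?_)).trans (by simp)
        set u := t / √(n : ℝ) * (σ g - n * c)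
        set w := t / √(n : ℝ) * (β g x - n * c)
        have h3 : Complex.exp ((u : ℝ) * Complex.I) - Complex.exp ((w : ℝ) * Complex.I) =
            Complex.exp ((w : ℝ) * Complex.I) *
              (Complex.exp (Complex.I * ((u - w : ℝ) : ℂ)) - 1) := by
          rw [mul_sub, ← Complex.exp_add, mul_one]
          congr 2
          push_cast
          ring
        rw [h3, norm_mul, Complex.norm_exp_ofReal_mul_I, one_mul]
        refine Real.norm_exp_I_mul_ofReal_sub_one_le.trans ?_
        have h4 : u - w = t / √(n : ℝ) * (σ g - β g x) := by
          simp only [u, w]; ring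
        rw [h4, Real.norm_eq_abs, abs_mul]
        exact mul_le_mul_of_nonneg_left (hσ g) (abs_nonneg _)
      · exact integrable_of_forall_norm_le _ (C := 1) fun g => by
          rw [Complex.norm_exp_ofReal_mul_I]
      · exact integrable_of_forall_norm_le _ (C := 1) fun g => by
          rw [Complex.norm_exp_ofReal_mul_I]
    simpa using h2.add h1
  obtain ⟨C, hC⟩ := hFb
  have hbcf := (ProbabilityMeasure.tendsto_iff_forall_integral_tendsto.1 hconv)
    (BoundedContinuousFunction.ofNormedAddCommGroup F hF C hC)
  have hint : ∀ n, ∫ y, F y ∂(law n : Measure ℝ) =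
      ∫ g, F ((σ g - n * c) / √(n : ℝ)) ∂(convPow μ n) := fun n => by
    simp only [hlaw, ProbabilityMeasure.coe_mk]
    rw [integral_map (hmeas n) hF.aestronglyMeasurable]
  simpa [hint, hgauss] using hbcf

end PointwiseCLT

/-! ### The Markov operator and the maximal ergodic inequality -/

section Markov

/-- The space of bounded measurable real functions. -/
def boundedMeasurable (Y : Type*) [MeasurableSpace Y] : Submodule ℝ (Y → ℝ) where
  carrier := {f | Measurable f ∧ ∃ C, ∀ y, |f y| ≤ C}
  add_mem' := by
    rintro f g ⟨hf, C, hC⟩ ⟨hg, C', hC'⟩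
    exact ⟨hf.add hg, C + C', fun y => (abs_add_le _ _).trans (add_le_add (hC y) (hC' y))⟩
  zero_mem' := ⟨measurable_zero, 0, fun y => by simp⟩
  smul_mem' := by
    rintro a f ⟨hf, C, hC⟩
    refine ⟨hf.const_smul a, |a| * C, fun y => ?_⟩
    simp only [Pi.smul_apply, smul_eq_mul, abs_mul]
    exact mul_le_mul_of_nonneg_left (hC y) (abs_nonneg a)

variable {Y : Type*} [MeasurableSpace Y]

theorem boundedMeasurable.integrable (ν : Measure Y) [IsFiniteMeasure ν] (f : boundedMeasurable Y) :
    Integrable (f : Y → ℝ) ν := by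
  obtain ⟨C, hC⟩ := f.2.2
  exact Integrable.of_bound f.2.1.aestronglyMeasurable C (Eventually.of_forall hC)

variable {G : Type*} [Group G] [Countable G] [MeasurableSpace G] [DiscreteMeasurableSpace G]
  [MulAction G Y]

theorem boundedMeasurable.integrable_smul (m : Measure G) [IsFiniteMeasure m]
    (f : boundedMeasurable Y) (y : Y) :
    Integrable (fun a : G => (f : Y → ℝ) (a • y)) m := by
  obtain ⟨C, hC⟩ := f.2.2
  exact integrable_of_forall_norm_le m fun a => hC _

variable [MeasurableConstSMul G Y] (μ : Measure G) [IsProbabilityMeasure μ]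

/-- The Markov operator `P f(y) = ∫ f(a y) dμ(a)` of the random walk, on bounded measurable
functions. -/
noncomputable def markovOp : boundedMeasurable Y →ₗ[ℝ] boundedMeasurable Y where
  toFun f := ⟨fun y => ∫ a, (f : Y → ℝ) (a • y) ∂μ, by
    refine ⟨(StronglyMeasurable.integral_prod_left (f := fun (a : G) y => (f : Y → ℝ) (a • y))
      (f.2.1.comp measurable_smul_prod).stronglyMeasurable).measurable, ?_⟩
    obtain ⟨C, hC⟩ := f.2.2
    refine ⟨C, fun y => ?_⟩
    have h := norm_integral_le_of_norm_le_const (μ := μ) (f := fun a : G => (f : Y → ℝ) (a • y))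
      (Eventually.of_forall fun a => hC (a • y))
    simpa using h⟩
  map_add' f g := by
    ext y
    exact integral_add (boundedMeasurable.integrable_smul μ f y)
      (boundedMeasurable.integrable_smul μ g y)
  map_smul' r f := by
    ext y
    exact integral_const_mul r _

theorem markovOp_apply (f : boundedMeasurable Y) (y : Y) :
    (markovOp μ f : Y → ℝ) y = ∫ a, (f : Y → ℝ) (a • y) ∂μ := rfl

theorem markovOp_mono {f g : boundedMeasurable Y} (h : (f : Y → ℝ) ≤ g) :
    (markovOp μ f : Y → ℝ) ≤ markovOp μ g := fun y =>
  integral_mono (boundedMeasurable.integrable_smul μ f y)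
    (boundedMeasurable.integrable_smul μ g y) fun _ => h _

/-- The powers of the Markov operator are given by the convolution powers of `μ`. -/
theorem integral_convPow_smul (k : ℕ) (f : boundedMeasurable Y) (x : Y) :
    ∫ g, (f : Y → ℝ) (g • x) ∂(convPow μ k) = (((markovOp μ) ^ k) f : Y → ℝ) x := by
  induction k generalizing f with
  | zero =>
    change ∫ g, (f : Y → ℝ) (g • x) ∂(Measure.dirac (1 : G)) = _
    rw [integral_dirac]
    simp
  | succ k ih =>
    obtain ⟨C, hC⟩ := f.2.2
    rw [integral_convPow_succ μ k (H := fun g => (f : Y → ℝ) (g • x)) (C := C) fun g => hC _]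
    simp only [mul_smul]
    rw [pow_succ, Module.End.mul_apply, ← ih]
    rfl

theorem integral_markovOp {ν : Measure Y} [IsProbabilityMeasure ν] (hν : IsStationaryMeasure μ ν)
    (f : boundedMeasurable Y) :
    ∫ y, (markovOp μ f : Y → ℝ) y ∂ν = ∫ y, (f : Y → ℝ) y ∂ν := by
  rw [← hν.integral_smul (boundedMeasurable.integrable ν f)]
  exact integral_integral_swap (f := fun y a => (f : Y → ℝ) (a • y))
    ((hν.measurePreserving.integrable_comp_of_integrable (boundedMeasurable.integrable ν f)).swap)

/-- The constant function `1`. -/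
def boundedMeasurableOne : boundedMeasurable Y :=
  ⟨fun _ => 1, measurable_const, 1, fun _ => by simp⟩

theorem markovOp_one : markovOp μ (boundedMeasurableOne : boundedMeasurable Y) =
    boundedMeasurableOne := by
  ext y
  simp [markovOp_apply, boundedMeasurableOne]

theorem markovOp_pow_one (k : ℕ) :
    ((markovOp μ) ^ k) (boundedMeasurableOne : boundedMeasurable Y) = boundedMeasurableOne := by
  induction k with
  | zero => simp
  | succ k ih => rw [pow_succ, Module.End.mul_apply, markovOp_one, ih]

/-- The positive part of a bounded measurable function. -/
def boundedMeasurablePos (f : boundedMeasurable Y) : boundedMeasurable Y :=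
  ⟨fun y => max 0 ((f : Y → ℝ) y), measurable_const.max f.2.1, by
    obtain ⟨C, hC⟩ := f.2.2
    refine ⟨C, fun y => ?_⟩
    rw [abs_of_nonneg (le_max_left _ _)]
    exact max_le ((abs_nonneg _).trans (hC y)) ((le_abs_self _).trans (hC y))⟩

/-- The absolute value of a bounded measurable function. -/
def boundedMeasurableAbs (f : boundedMeasurable Y) : boundedMeasurable Y :=
  ⟨fun y => |(f : Y → ℝ) y|, f.2.1.abs, by
    obtain ⟨C, hC⟩ := f.2.2
    exact ⟨C, fun y => by simpa using hC y⟩⟩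

/-- The sequence `M₀ = 0`, `Mₙ₊₁ = max(0, f + P Mₙ)`, which bounds from above the sums
`f + P f + ⋯ + P^{k-1} f` for `k ≤ n` and can replace their maximum in Garsia's proof of the
maximal ergodic theorem. -/
noncomputable def garsiaMax (f : boundedMeasurable Y) : ℕ → boundedMeasurable Y
  | 0 => 0
  | n + 1 => boundedMeasurablePos (f + markovOp μ (garsiaMax f n))

theorem garsiaMax_succ_apply (f : boundedMeasurable Y) (n : ℕ) (y : Y) :
    (garsiaMax μ f (n + 1) : Y → ℝ) y =
      max 0 ((f : Y → ℝ) y + (markovOp μ (garsiaMax μ f n) : Y → ℝ) y) := rfl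

theorem garsiaMax_nonneg (f : boundedMeasurable Y) (n : ℕ) (y : Y) :
    0 ≤ (garsiaMax μ f n : Y → ℝ) y := by
  cases n with
  | zero => exact le_rfl
  | succ n => exact le_max_left _ _

theorem garsiaMax_le_succ (f : boundedMeasurable Y) (n : ℕ) :
    (garsiaMax μ f n : Y → ℝ) ≤ garsiaMax μ f (n + 1) := by
  induction n with
  | zero => exact fun y => garsiaMax_nonneg μ f 1 y
  | succ n ih =>
    intro y
    rw [garsiaMax_succ_apply, garsiaMax_succ_apply μ f (n + 1)]
    exact max_le_max le_rfl (add_le_add le_rfl (markovOp_mono μ ih y))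

/-- The induction step is `f + ⋯ + Pⁿ f = f + P (f + ⋯ + Pⁿ⁻¹ f)` and positivity of `P`. -/
theorem sum_pow_le_garsiaMax (f : boundedMeasurable Y) (n : ℕ) :
    ((∑ k ∈ Finset.range n, ((markovOp μ) ^ k) f : boundedMeasurable Y) : Y → ℝ) ≤
      garsiaMax μ f n := by
  induction n with
  | zero => simp [garsiaMax]
  | succ n ih =>
    have h : ∑ k ∈ Finset.range (n + 1), ((markovOp μ) ^ k) f =
        f + markovOp μ (∑ k ∈ Finset.range n, ((markovOp μ) ^ k) f) := by
      rw [Finset.sum_range_succ', map_sum, add_comm]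
      simp [pow_succ', Module.End.mul_apply]
    rw [h]
    intro y
    exact (add_le_add le_rfl (markovOp_mono μ ih y)).trans (le_max_right _ _)

variable {ν : Measure Y} [IsProbabilityMeasure ν]

/-- Hopf's maximal ergodic theorem for the Markov operator. -/
theorem setIntegral_garsiaMax_pos_nonneg (hν : IsStationaryMeasure μ ν) (f : boundedMeasurable Y)
    (n : ℕ) : 0 ≤ ∫ y in {y | 0 < (garsiaMax μ f n : Y → ℝ) y}, (f : Y → ℝ) y ∂ν := by
  cases n with
  | zero => simp [garsiaMax]
  | succ n =>
    set m := garsiaMax μ f (n + 1) with hm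
    set E := {y | 0 < (m : Y → ℝ) y} with hE
    have hEm : MeasurableSet E := measurableSet_lt measurable_const m.2.1
    have h1 : ∫ y in E, ((m : Y → ℝ) y - (markovOp μ m : Y → ℝ) y) ∂ν ≤
        ∫ y in E, (f : Y → ℝ) y ∂ν := by
      refine setIntegral_mono_on ((boundedMeasurable.integrable ν m).sub
        (boundedMeasurable.integrable ν _)).integrableOn
        (boundedMeasurable.integrable ν f).integrableOn hEm fun y hy => ?_
      have h2 : (m : Y → ℝ) y = (f : Y → ℝ) y + (markovOp μ (garsiaMax μ f n) : Y → ℝ) y := by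
        have h3 : 0 < (m : Y → ℝ) y := hy
        rw [hm, garsiaMax_succ_apply] at h3 ⊢
        rcases lt_max_iff.1 h3 with h | h
        · exact absurd h (lt_irrefl _)
        · exact max_eq_right h.le
      have h4 := markovOp_mono μ (garsiaMax_le_succ μ f n) y
      rw [h2]
      linarith
    refine le_trans ?_ h1
    rw [integral_sub (boundedMeasurable.integrable ν m).integrableOn
      (boundedMeasurable.integrable ν _).integrableOn]
    have h5 : ∫ y in E, (m : Y → ℝ) y ∂ν = ∫ y, (m : Y → ℝ) y ∂ν := by
      refine setIntegral_eq_integral_of_forall_compl_eq_zero fun y hy => ?_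
      exact le_antisymm (not_lt.1 hy) (garsiaMax_nonneg μ f _ y)
    have h6 : ∫ y in E, (markovOp μ m : Y → ℝ) y ∂ν ≤ ∫ y, (markovOp μ m : Y → ℝ) y ∂ν := by
      refine setIntegral_le_integral (boundedMeasurable.integrable ν _)
        (Eventually.of_forall fun y => ?_)
      exact integral_nonneg fun a => garsiaMax_nonneg μ f _ _
    rw [integral_markovOp μ hν] at h6
    linarith

/-- The weak type inequality for the ergodic averages of a nonnegative function. -/
theorem measure_exists_lt_sum_le (hν : IsStationaryMeasure μ ν) (f : boundedMeasurable Y)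
    (hf : ∀ y, 0 ≤ (f : Y → ℝ) y) {δ : ℝ} (hδ : 0 < δ) :
    ν {y | ∃ n : ℕ, δ * n <
      ((∑ k ∈ Finset.range n, ((markovOp μ) ^ k) f : boundedMeasurable Y) : Y → ℝ) y} ≤
      ENNReal.ofReal ((∫ y, (f : Y → ℝ) y ∂ν) / δ) := by
  set f' : boundedMeasurable Y := f - δ • boundedMeasurableOne with hf'
  set E : ℕ → Set Y := fun n => {y | 0 < (garsiaMax μ f' n : Y → ℝ) y} with hE
  have hEm : ∀ n, MeasurableSet (E n) := fun n =>
    measurableSet_lt measurable_const (garsiaMax μ f' n).2.1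
  have hsub : {y | ∃ n : ℕ, δ * n <
      ((∑ k ∈ Finset.range n, ((markovOp μ) ^ k) f : boundedMeasurable Y) : Y → ℝ) y} ⊆
      ⋃ n, E n := by
    rintro y ⟨n, hn⟩
    refine Set.mem_iUnion.2 ⟨n, lt_of_lt_of_le ?_ (sum_pow_le_garsiaMax μ f' n y)⟩
    have h1 : ∑ k ∈ Finset.range n, ((markovOp μ) ^ k) f' =
        ∑ k ∈ Finset.range n, ((markovOp μ) ^ k) f - (n : ℝ) • δ • boundedMeasurableOne := by
      simp only [hf', map_sub, map_smul, markovOp_pow_one, Finset.sum_sub_distrib,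
        Finset.sum_const, Finset.card_range, Nat.cast_smul_eq_nsmul]
    rw [h1]
    have h2 : (((n : ℝ) • δ • (boundedMeasurableOne : boundedMeasurable Y) :
        boundedMeasurable Y) : Y → ℝ) y = δ * n := by
      simp [boundedMeasurableOne, mul_comm]
    rw [Submodule.coe_sub, Pi.sub_apply, h2]
    linarith
  have hmono : Monotone E := monotone_nat_of_le_succ fun n y hy =>
    lt_of_lt_of_le hy (garsiaMax_le_succ μ f' n y)
  have hEn : ∀ n, ν (E n) ≤ ENNReal.ofReal ((∫ y, (f : Y → ℝ) y ∂ν) / δ) := by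
    intro n
    rw [← ofReal_measureReal]
    refine ENNReal.ofReal_le_ofReal ?_
    rw [le_div_iff₀ hδ]
    have h1 := setIntegral_garsiaMax_pos_nonneg μ hν f' n
    have h2 : ∫ y in E n, (f' : Y → ℝ) y ∂ν =
        ∫ y in E n, (f : Y → ℝ) y ∂ν - ν.real (E n) * δ := by
      have : (f' : Y → ℝ) = fun y => (f : Y → ℝ) y - δ := by
        ext y
        simp [hf', boundedMeasurableOne]
      rw [this, integral_sub (boundedMeasurable.integrable ν f).integrableOn (integrable_const _)]
      simp
    have h3 : ∫ y in E n, (f : Y → ℝ) y ∂ν ≤ ∫ y, (f : Y → ℝ) y ∂ν :=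
      setIntegral_le_integral (boundedMeasurable.integrable ν f) (Eventually.of_forall hf)
    rw [h2] at h1
    linarith
  refine (measure_mono hsub).trans ?_
  rw [hmono.measure_iUnion]
  exact iSup_le hEn

end Markov

/-! ### Ergodicity and almost coboundaries -/

section Ergodic

variable {G : Type*} [Group G] [MeasurableSpace G] {Y : Type*} [MeasurableSpace Y] [MulAction G Y]
  {μ : Measure G} {ν : Measure Y} [IsProbabilityMeasure ν]

/-- For an ergodic stationary measure, a measurable function which is invariant along the walk is
almost surely constant. -/
theorem IsWalkErgodic.ae_eq_const (hν : IsWalkErgodic μ ν) {f : Y → ℝ} (hf : Measurable f)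
    (hinv : ∀ᵐ p : G × Y ∂(μ.prod ν), f (p.1 • p.2) = f p.2) : ∃ a, f =ᵐ[ν] Function.const Y a := by
  refine exists_eventuallyEq_const_of_forall_separating MeasurableSet fun U hU => ?_
  have hU' : ∀ᵐ g ∂μ, (fun y => g • y) ⁻¹' (f ⁻¹' U) =ᵐ[ν] f ⁻¹' U := by
    filter_upwards [Measure.ae_ae_of_ae_prod hinv] with g hg
    rw [eventuallyEq_set]
    filter_upwards [hg] with y hy
    change f (g • y) ∈ U ↔ f y ∈ U
    rw [hy]
  rcases hν (f ⁻¹' U) (hf hU) hU' with h | h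
  · exact Or.inr (measure_eq_zero_iff_ae_notMem.1 h)
  · exact Or.inl (by simpa using measure_eq_zero_iff_ae_notMem.1 h)

theorem boundedMeasurable.memLp_two (ν : Measure Y) [IsProbabilityMeasure ν]
    (f : boundedMeasurable Y) :
    MemLp (f : Y → ℝ) 2 ν := by
  obtain ⟨C, hC⟩ := f.2.2
  exact MemLp.of_bound f.2.1.aestronglyMeasurable C (Eventually.of_forall hC)

/-- The class in `L²(ν)` of a bounded measurable function. -/
noncomputable def boundedMeasurableToLp (ν : Measure Y) [IsProbabilityMeasure ν] :
    boundedMeasurable Y →ₗ[ℝ] Lp ℝ 2 ν where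
  toFun f := (boundedMeasurable.memLp_two ν f).toLp (f : Y → ℝ)
  map_add' _ _ := rfl
  map_smul' _ _ := rfl

theorem boundedMeasurableToLp_coeFn (f : boundedMeasurable Y) :
    boundedMeasurableToLp ν f =ᵐ[ν] (f : Y → ℝ) := (boundedMeasurable.memLp_two ν f).coeFn_toLp

theorem integral_abs_le_norm_toLp (f : boundedMeasurable Y) :
    ∫ y, |(f : Y → ℝ) y| ∂ν ≤ ‖boundedMeasurableToLp ν f‖ := by
  have hm := f.2.1.aestronglyMeasurable (μ := ν)
  have h1 : ∫ y, |(f : Y → ℝ) y| ∂ν = (eLpNorm (f : Y → ℝ) 1 ν).toReal := by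
    rw [eLpNorm_one_eq_lintegral_enorm, ← integral_norm_eq_lintegral_enorm hm]
    rfl
  rw [h1]
  change _ ≤ ‖(boundedMeasurable.memLp_two ν f).toLp (f : Y → ℝ)‖
  rw [Lp.norm_toLp]
  exact ENNReal.toReal_mono (boundedMeasurable.memLp_two ν f).2.ne
    (eLpNorm_le_eLpNorm_of_exponent_le (by norm_num) hm)

variable [Countable G] [DiscreteMeasurableSpace G] [IsProbabilityMeasure μ]
  [MeasurableConstSMul G Y]

/-- The isometric embedding of `L²(ν)` in `L²(μ ⊗ ν)` by composition with the action map. -/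
noncomputable def actionIsometry (hν : IsStationaryMeasure μ ν) :
    Lp ℝ 2 ν →ₗᵢ[ℝ] Lp ℝ 2 (μ.prod ν) :=
  Lp.compMeasurePreservingₗᵢ ℝ (fun p : G × Y => p.1 • p.2) hν.measurePreserving

/-- The isometric embedding of `L²(ν)` in `L²(μ ⊗ ν)` by composition with the projection. -/
noncomputable def projIsometry (μ : Measure G) [IsProbabilityMeasure μ] (ν : Measure Y)
    [IsProbabilityMeasure ν] : Lp ℝ 2 ν →ₗᵢ[ℝ] Lp ℝ 2 (μ.prod ν) :=
  Lp.compMeasurePreservingₗᵢ ℝ (Prod.snd : G × Y → Y) measurePreserving_snd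

/-- The Markov operator on `L²(ν)`, as the composition of `actionIsometry` with the adjoint of
`projIsometry`; in this form it is clearly a contraction. -/
noncomputable def markovOpLp (hν : IsStationaryMeasure μ ν) : Lp ℝ 2 ν →L[ℝ] Lp ℝ 2 ν :=
  ContinuousLinearMap.adjoint (projIsometry μ ν).toContinuousLinearMap ∘L
    (actionIsometry hν).toContinuousLinearMap

theorem inner_markovOpLp (hν : IsStationaryMeasure μ ν) (φ f : Lp ℝ 2 ν) :
    inner ℝ φ (markovOpLp hν f) = inner ℝ (projIsometry μ ν φ) (actionIsometry hν f) := by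
  rw [markovOpLp, ContinuousLinearMap.comp_apply, ContinuousLinearMap.adjoint_inner_right]
  rfl

theorem norm_markovOpLp_le (hν : IsStationaryMeasure μ ν) : ‖markovOpLp hν‖ ≤ 1 := by
  refine (ContinuousLinearMap.opNorm_comp_le _ _).trans ?_
  rw [LinearIsometryEquiv.norm_map]
  exact mul_le_one₀ (LinearIsometry.norm_toContinuousLinearMap_le _) (norm_nonneg _)
    (LinearIsometry.norm_toContinuousLinearMap_le _)

theorem markovOpLp_toLp (hν : IsStationaryMeasure μ ν) (f : boundedMeasurable Y) :
    markovOpLp hν (boundedMeasurableToLp ν f) = boundedMeasurableToLp ν (markovOp μ f) := by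
  refine ext_inner_left ℝ fun φ => ?_
  rw [inner_markovOpLp, L2.inner_def, L2.inner_def]
  have h1 : projIsometry μ ν φ =ᵐ[μ.prod ν] φ ∘ Prod.snd :=
    Lp.coeFn_compMeasurePreserving φ measurePreserving_snd
  have h2 : actionIsometry hν (boundedMeasurableToLp ν f) =ᵐ[μ.prod ν]
      fun p : G × Y => (f : Y → ℝ) (p.1 • p.2) :=
    (Lp.coeFn_compMeasurePreserving _ hν.measurePreserving).trans
      (hν.measurePreserving.quasiMeasurePreserving.ae_eq_comp (boundedMeasurableToLp_coeFn f))
  have hφ : Integrable (φ : Y → ℝ) ν := (Lp.memLp φ).integrable (by norm_num)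
  obtain ⟨C, hC⟩ := f.2.2
  have hint : Integrable (fun p : G × Y => (φ : Y → ℝ) p.2 * (f : Y → ℝ) (p.1 • p.2))
      (μ.prod ν) := by
    refine (hφ.comp_snd μ).mul_bdd (c := C) ?_ (Eventually.of_forall fun p => hC _)
    exact (f.2.1.comp measurable_smul_prod).aestronglyMeasurable
  calc ∫ p, inner ℝ (projIsometry μ ν φ p) (actionIsometry hν (boundedMeasurableToLp ν f) p)
        ∂(μ.prod ν)
      = ∫ p : G × Y, (φ : Y → ℝ) p.2 * (f : Y → ℝ) (p.1 • p.2) ∂(μ.prod ν) := by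
        refine integral_congr_ae ?_
        filter_upwards [h1, h2] with p hp1 hp2
        rw [hp1, hp2]
        simp [mul_comm]
    _ = ∫ y, ∫ a, (φ : Y → ℝ) y * (f : Y → ℝ) (a • y) ∂μ ∂ν := integral_prod_symm _ hint
    _ = _ := by
        refine integral_congr_ae ?_
        filter_upwards [boundedMeasurableToLp_coeFn (ν := ν) (markovOp μ f)] with y hy
        rw [hy, integral_const_mul, markovOp_apply]
        simp [mul_comm]

/-- A fixed vector of the Markov operator on `L²` is invariant along the walk: equality holds in
the Cauchy-Schwarz inequality. -/
theorem ae_smul_eq_of_markovOpLp_eq (hν : IsStationaryMeasure μ ν) {φ : Lp ℝ 2 ν}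
    (hφ : markovOpLp hν φ = φ) :
    ∀ᵐ p : G × Y ∂(μ.prod ν), (φ : Y → ℝ) (p.1 • p.2) = (φ : Y → ℝ) p.2 := by
  have h1 : inner ℝ (projIsometry μ ν φ) (actionIsometry hν φ) = ‖φ‖ * ‖φ‖ := by
    rw [← inner_markovOpLp, hφ, real_inner_self_eq_norm_mul_norm]
  have h2 : projIsometry μ ν φ = actionIsometry hν φ := by
    rw [← sub_eq_zero, ← norm_eq_zero, ← mul_self_eq_zero, norm_sub_mul_self_real, h1,
      LinearIsometry.norm_map, LinearIsometry.norm_map]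
    ring
  have h3 : projIsometry μ ν φ =ᵐ[μ.prod ν] φ ∘ Prod.snd :=
    Lp.coeFn_compMeasurePreserving φ measurePreserving_snd
  have h4 : actionIsometry hν φ =ᵐ[μ.prod ν] φ ∘ fun p : G × Y => p.1 • p.2 :=
    Lp.coeFn_compMeasurePreserving φ hν.measurePreserving
  rw [← h2] at h4
  filter_upwards [h3, h4] with p hp3 hp4
  exact hp4.symm.trans hp3

theorem integral_markovOp_pow (hν : IsStationaryMeasure μ ν) (f : boundedMeasurable Y) (k : ℕ) :
    ∫ y, (((markovOp μ) ^ k) f : Y → ℝ) y ∂ν = ∫ y, (f : Y → ℝ) y ∂ν := by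
  induction k with
  | zero => simp
  | succ k ih => rw [pow_succ', Module.End.mul_apply, integral_markovOp μ hν, ih]

theorem inner_one_toLp (f : boundedMeasurable Y) :
    inner ℝ (boundedMeasurableToLp ν boundedMeasurableOne) (boundedMeasurableToLp ν f) =
      ∫ y, (f : Y → ℝ) y ∂ν := by
  rw [L2.inner_def]
  refine integral_congr_ae ?_
  filter_upwards [boundedMeasurableToLp_coeFn (ν := ν) f,
    boundedMeasurableToLp_coeFn (ν := ν) boundedMeasurableOne] with y h1 h2
  rw [h1, h2]
  simp [boundedMeasurableOne]

/-- The ergodic average `(1/n) ∑_{k<n} P^k f`. -/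
noncomputable def ergodicAverage (μ : Measure G) [IsProbabilityMeasure μ] (n : ℕ)
    (f : boundedMeasurable Y) : boundedMeasurable Y :=
  (n : ℝ)⁻¹ • ∑ k ∈ Finset.range n, ((markovOp μ) ^ k) f

theorem toLp_ergodicAverage (hν : IsStationaryMeasure μ ν) (n : ℕ) (f : boundedMeasurable Y) :
    boundedMeasurableToLp ν (ergodicAverage μ n f) =
      birkhoffAverage ℝ (markovOpLp hν) _root_.id n (boundedMeasurableToLp ν f) := by
  have h : ∀ k, (markovOpLp hν)^[k] (boundedMeasurableToLp ν f) =
      boundedMeasurableToLp ν (((markovOp μ) ^ k) f) := by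
    intro k
    induction k with
    | zero => simp
    | succ k ih => rw [Function.iterate_succ_apply', ih, markovOpLp_toLp, pow_succ',
        Module.End.mul_apply]
  simp only [ergodicAverage, birkhoffAverage, birkhoffSum, map_smul, map_sum, h, id]

/-- The mean ergodic theorem for the Markov operator of an ergodic stationary measure. -/
theorem tendsto_integral_abs_ergodicAverage (hν : IsStationaryMeasure μ ν)
    (hν_erg : IsWalkErgodic μ ν) {f : boundedMeasurable Y} (hf : ∫ y, (f : Y → ℝ) y ∂ν = 0) :
    Tendsto (fun n => ∫ y, |(ergodicAverage μ n f : Y → ℝ) y| ∂ν) atTop (𝓝 0) := by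
  have hlim := (markovOpLp hν).tendsto_birkhoffAverage_orthogonalProjection
    (norm_markovOpLp_le hν) (boundedMeasurableToLp ν f)
  simp_rw [← toLp_ergodicAverage] at hlim
  set p : Lp ℝ 2 ν := (((markovOpLp hν).eqLocus
    (1 : Lp ℝ 2 ν →L[ℝ] Lp ℝ 2 ν)).orthogonalProjectionOnto (boundedMeasurableToLp ν f) :
      Lp ℝ 2 ν) with hp
  have hfix : markovOpLp hν p = p := (((markovOpLp hν).eqLocus
    (1 : Lp ℝ 2 ν →L[ℝ] Lp ℝ 2 ν)).orthogonalProjectionOnto (boundedMeasurableToLp ν f)).2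
  obtain ⟨a, ha⟩ := hν_erg.ae_eq_const (Lp.stronglyMeasurable p).measurable
    (ae_smul_eq_of_markovOpLp_eq hν hfix)
  have hpa : p = boundedMeasurableToLp ν (a • boundedMeasurableOne) := by
    refine Lp.ext (ha.trans ?_)
    filter_upwards [boundedMeasurableToLp_coeFn (ν := ν) (a • boundedMeasurableOne)] with y hy
    rw [hy]
    simp [boundedMeasurableOne]
  have hzero : ∀ n, inner ℝ (boundedMeasurableToLp ν boundedMeasurableOne)
      (boundedMeasurableToLp ν (ergodicAverage μ n f)) = 0 := by
    intro n
    simp only [ergodicAverage, map_smul, map_sum, inner_smul_right, inner_sum, inner_one_toLp,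
      integral_markovOp_pow hν, hf, Finset.sum_const_zero, mul_zero]
  have hp1 : inner ℝ (boundedMeasurableToLp ν boundedMeasurableOne) p = 0 := by
    refine tendsto_nhds_unique (tendsto_const_nhds.inner hlim) ?_
    simp_rw [hzero]
    exact tendsto_const_nhds
  have ha0 : a = 0 := by
    rw [hpa, inner_one_toLp] at hp1
    simpa [boundedMeasurableOne] using hp1
  rw [hpa, ha0, zero_smul, map_zero] at hlim
  exact squeeze_zero (fun n => integral_nonneg fun y => abs_nonneg _)
    (fun n => integral_abs_le_norm_toLp _) (by simpa using hlim.norm)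

/-- A bounded function of zero mean is, up to its `n`-th ergodic average, a coboundary. -/
theorem exists_sub_markovOp_eq (W : boundedMeasurable Y) {n : ℕ} (hn : n ≠ 0) :
    ∃ U : boundedMeasurable Y, W = U - markovOp μ U + ergodicAverage μ n W := by
  refine ⟨(n : ℝ)⁻¹ • ∑ k ∈ Finset.range n, ∑ j ∈ Finset.range k, ((markovOp μ) ^ j) W, ?_⟩
  have h1 : ∀ k : ℕ, ∑ j ∈ Finset.range k, ((markovOp μ) ^ j) W -
      markovOp μ (∑ j ∈ Finset.range k, ((markovOp μ) ^ j) W) = W - ((markovOp μ) ^ k) W := by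
    intro k
    induction k with
    | zero => simp
    | succ k ih =>
      rw [Finset.sum_range_succ, map_add, add_sub_add_comm, ih, ← Module.End.mul_apply,
        ← pow_succ']
      abel
  have h2 : W = (n : ℝ)⁻¹ • ((∑ k ∈ Finset.range n, ∑ j ∈ Finset.range k, ((markovOp μ) ^ j) W -
      markovOp μ (∑ k ∈ Finset.range n, ∑ j ∈ Finset.range k, ((markovOp μ) ^ j) W)) +
      ∑ k ∈ Finset.range n, ((markovOp μ) ^ k) W) := by
    rw [map_sum, ← Finset.sum_sub_distrib, ← Finset.sum_add_distrib]
    simp only [h1, sub_add_cancel, Finset.sum_const, Finset.card_range]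
    rw [← Nat.cast_smul_eq_nsmul ℝ, smul_smul, inv_mul_cancel₀ (by exact_mod_cast hn), one_smul]
  conv_lhs => rw [h2]
  rw [map_smul, ergodicAverage]
  module

/-- A bounded function of zero mean is an almost coboundary along the walk started at almost every
point. The remainders are the ergodic averages of the function, small in `L¹` by the mean ergodic
theorem; the weak type inequality turns this into a pointwise bound. -/
theorem ae_isAlmostCoboundaryAt (hν : IsStationaryMeasure μ ν) (hν_erg : IsWalkErgodic μ ν)
    {W : boundedMeasurable Y} (hW : ∫ y, (W : Y → ℝ) y ∂ν = 0) :
    ∀ᵐ x ∂ν, IsAlmostCoboundaryAt μ (W : Y → ℝ) x := by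
  have hlim := tendsto_integral_abs_ergodicAverage hν hν_erg hW
  have hgood : ∀ m : ℕ, ∀ᵐ x ∂ν, ∃ N : ℕ, N ≠ 0 ∧ ∀ n : ℕ,
      ((∑ k ∈ Finset.range n, ((markovOp μ) ^ k) (boundedMeasurableAbs (ergodicAverage μ N W)) :
        boundedMeasurable Y) : Y → ℝ) x ≤ 1 / ((m : ℝ) + 1) * n := by
    intro m
    set δ : ℝ := 1 / ((m : ℝ) + 1) with hδ
    have hδ0 : 0 < δ := by positivity
    rw [ae_iff]
    have hbound : ∀ N : ℕ, N ≠ 0 → ν {x | ¬ ∃ N : ℕ, N ≠ 0 ∧ ∀ n : ℕ,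
        ((∑ k ∈ Finset.range n, ((markovOp μ) ^ k) (boundedMeasurableAbs (ergodicAverage μ N W)) :
          boundedMeasurable Y) : Y → ℝ) x ≤ δ * n} ≤
        ENNReal.ofReal ((∫ y, |(ergodicAverage μ N W : Y → ℝ) y| ∂ν) / δ) := by
      intro N hN
      refine (measure_mono fun x hx => ?_).trans (measure_exists_lt_sum_le μ hν
        (boundedMeasurableAbs (ergodicAverage μ N W)) (fun y => abs_nonneg _) hδ0)
      by_contra hcon
      exact hx ⟨N, hN, fun n => not_lt.1 fun hn => hcon ⟨n, hn⟩⟩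
    have hlim' : Tendsto (fun N => ENNReal.ofReal
        ((∫ y, |(ergodicAverage μ N W : Y → ℝ) y| ∂ν) / δ)) atTop (𝓝 0) := by
      simpa using ENNReal.tendsto_ofReal (hlim.div_const δ)
    refine le_antisymm (ge_of_tendsto hlim' ?_) zero_le
    filter_upwards [eventually_ne_atTop 0] with N hN using hbound N hN
  filter_upwards [ae_all_iff.2 hgood] with x hx
  intro ε hε
  obtain ⟨m, hm⟩ := exists_nat_one_div_lt hε
  obtain ⟨N, hN, hn⟩ := hx m
  obtain ⟨U, hU⟩ := exists_sub_markovOp_eq (μ := μ) W hN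
  obtain ⟨B, hB⟩ := U.2.2
  obtain ⟨B', hB'⟩ := (ergodicAverage μ N W).2.2
  refine ⟨U, ergodicAverage μ N W, B, B', hB, hB', fun y => ?_, fun n => ?_⟩
  · conv_lhs => rw [hU]
    rfl
  · have h1 : ∀ k, ∫ g, |(ergodicAverage μ N W : Y → ℝ) (g • x)| ∂(convPow μ k) =
        (((markovOp μ) ^ k) (boundedMeasurableAbs (ergodicAverage μ N W)) : Y → ℝ) x :=
      fun k => integral_convPow_smul μ k (boundedMeasurableAbs (ergodicAverage μ N W)) x
    simp_rw [h1]
    have h2 := hn n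
    rw [Submodule.coe_sum, Finset.sum_apply] at h2
    exact h2.trans (mul_le_mul_of_nonneg_right hm.le n.cast_nonneg)

end Ergodic

/-! ### Centered cocycles over an ergodic stationary space -/

section Centering

variable {G : Type*} [MeasurableSpace G] {μ : Measure G}

theorem integrable_add_const_sq [IsProbabilityMeasure μ] {D : G → ℝ}
    (hD2 : Integrable (fun g => D g ^ 2) μ) (hD : Integrable D μ) (M : ℝ) :
    Integrable (fun g => (D g + M) ^ 2) μ := by
  have h : (fun g => (D g + M) ^ 2) = fun g => D g ^ 2 + 2 * M * D g + M ^ 2 := by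
    ext g
    ring
  rw [h]
  exact (hD2.add (hD.const_mul _)).add (integrable_const _)

theorem integrable_of_integrable_sq [Countable G] [DiscreteMeasurableSpace G]
    [IsProbabilityMeasure μ] {D : G → ℝ} (hD2 : Integrable (fun g => D g ^ 2) μ) :
    Integrable D μ := by
  have h : MemLp D 2 μ := (memLp_two_iff_integrable_sq AEStronglyMeasurable.of_discrete).2 hD2
  exact h.integrable (by norm_num)

variable [Group G] {Y : Type*} [MeasurableSpace Y] [MulAction G Y] {ν : Measure Y}
  {b β₀ β₁ : G → Y → ℝ} {ψ ψ' : Y → ℝ} {c c' : ℝ}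

/-- A dominated function and its centering differ by a bounded function, so the centering is
dominated as well. -/
theorem IsCentering.exists_abs_sub_le (h : IsCentering μ b β₀ ψ c) {D : G → ℝ}
    (hbD : ∀ g y, |b g y| ≤ D g) :
    ∃ M, (∀ g y, |b g y - β₀ g y| ≤ M) ∧ ∀ g y, |β₀ g y - c| ≤ D g + M := by
  obtain ⟨M, hM⟩ := h.bounded_psi
  have h1 : ∀ g y, |b g y - β₀ g y| ≤ 2 * M := by
    intro g y
    have h2 : b g y - β₀ g y = ψ y - ψ (g • y) := by linarith [h.eq g y]
    rw [h2]
    linarith [abs_sub (ψ y) (ψ (g • y)), hM y, hM (g • y)]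
  refine ⟨2 * M + |c|, fun g y => (h1 g y).trans (by linarith [abs_nonneg c]), fun g y => ?_⟩
  have h3 : β₀ g y - c = b g y - (b g y - β₀ g y) - c := by ring
  rw [h3]
  linarith [abs_sub (b g y - (b g y - β₀ g y)) c, abs_sub (b g y) (b g y - β₀ g y), h1 g y,
    hbD g y]

variable [Countable G] [DiscreteMeasurableSpace G] [IsProbabilityMeasure μ]
  [IsProbabilityMeasure ν]

theorem IsCentering.integrable_sq (h : IsCentering μ b β₀ ψ c) {D : G → ℝ}
    (hD2 : Integrable (fun g => D g ^ 2) μ) (hbD : ∀ g y, |b g y| ≤ D g) :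
    Integrable (fun p : G × Y => (β₀ p.1 p.2 - c) ^ 2) (μ.prod ν) := by
  obtain ⟨M, -, hM⟩ := h.exists_abs_sub_le hbD
  have hDM := integrable_add_const_sq hD2 (integrable_of_integrable_sq hD2) M
  refine (hDM.comp_fst ν).mono'
    ((h.measurable_cocycle.sub_const c).pow_const 2).aestronglyMeasurable
    (Eventually.of_forall fun p => ?_)
  rw [Real.norm_of_nonneg (sq_nonneg _), ← sq_abs]
  exact pow_le_pow_left₀ (abs_nonneg _) (hM p.1 p.2) 2

variable [MeasurableConstSMul G Y]

/-- The drift of a centering does not depend on the centering. -/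
theorem IsCentering.drift_unique (hν : IsStationaryMeasure μ ν) (h : IsCentering μ b β₀ ψ c)
    (h' : IsCentering μ b β₁ ψ' c') : c = c' := by
  obtain ⟨M, hM⟩ := h.bounded_psi
  obtain ⟨M', hM'⟩ := h'.bounded_psi
  set φ : boundedMeasurable Y :=
    (⟨ψ, h.measurable_psi, M, hM⟩ : boundedMeasurable Y) - ⟨ψ', h'.measurable_psi, M', hM'⟩ with hφ
  have hφa : ∀ y, (φ : Y → ℝ) y = ψ y - ψ' y := fun _ => rfl
  have hpt : ∀ y, c - c' = (markovOp μ φ : Y → ℝ) y - (φ : Y → ℝ) y := by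
    intro y
    have h1 : ∀ g, β₀ g y - β₁ g y = (φ : Y → ℝ) (g • y) - (φ : Y → ℝ) y := by
      intro g
      rw [hφa, hφa]
      linarith [h.eq g y, h'.eq g y]
    have h2 : ∫ g, (β₀ g y - β₁ g y) ∂μ = c - c' := by
      rw [integral_sub (h.drift y).1 (h'.drift y).1, (h.drift y).2, (h'.drift y).2]
    rw [← h2]
    simp_rw [h1]
    rw [integral_sub (boundedMeasurable.integrable_smul μ φ y) (integrable_const _), markovOp_apply]
    simp
  have hint : ∫ _ : Y, (c - c') ∂ν = 0 := by
    rw [integral_congr_ae (Eventually.of_forall hpt),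
      integral_sub (boundedMeasurable.integrable ν _) (boundedMeasurable.integrable ν _),
      integral_markovOp μ hν, sub_self]
  simp only [integral_const, probReal_univ, one_smul] at hint
  linarith

/-- The central limit theorem for a dominated function with a centering, at almost every starting
point. -/
theorem IsCentering.ae_tendsto_gaussianReal (hν : IsStationaryMeasure μ ν)
    (hν_erg : IsWalkErgodic μ ν) (h : IsCentering μ b β₀ ψ c) {D : G → ℝ}
    (hD2 : Integrable (fun g => D g ^ 2) μ) (hbD : ∀ g y, |b g y| ≤ D g) :
    ∀ᵐ x ∂ν, ∀ F : ℝ → ℝ, Continuous F → (∃ C, ∀ t, |F t| ≤ C) →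
      Tendsto (fun n : ℕ => ∫ g, F ((b g x - n * c) / √n) ∂(convPow μ n)) atTop
        (𝓝 (∫ t, F t ∂(gaussianReal 0 (cocycleVariance μ ν β₀ c).toNNReal))) := by
  obtain ⟨M, hbM, hM⟩ := h.exists_abs_sub_le hbD
  have hD := integrable_of_integrable_sq hD2
  have hDM2 := integrable_add_const_sq hD2 hD M
  have hDM : Integrable (fun g => D g + M) μ := hD.add (integrable_const M)
  set v := cocycleVariance μ ν β₀ c with hv
  have hv0 : 0 ≤ v := integral_nonneg fun p => sq_nonneg _
  have hmean : ∀ y, ∫ a, (β₀ a y - c) ∂μ = 0 := by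
    intro y
    rw [integral_sub (h.drift y).1 (integrable_const _), (h.drift y).2]
    simp
  set W : boundedMeasurable Y := ⟨fun y => ∫ a, (β₀ a y - c) ^ 2 ∂μ - v, by
    refine ⟨Measurable.sub_const ?_ v, (∫ a, (D a + M) ^ 2 ∂μ) + v, fun y => ?_⟩
    · exact (StronglyMeasurable.integral_prod_left (f := fun a y => (β₀ a y - c) ^ 2)
        ((h.measurable_cocycle.sub_const c).pow_const 2).stronglyMeasurable).measurable
    · refine (abs_sub _ _).trans (add_le_add ?_ (abs_of_nonneg hv0).le)
      rw [abs_of_nonneg (integral_nonneg fun a => sq_nonneg _)]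
      refine integral_mono_of_nonneg (Eventually.of_forall fun a => sq_nonneg _) hDM2
        (Eventually.of_forall fun a => ?_)
      simp only
      rw [← sq_abs]
      exact pow_le_pow_left₀ (abs_nonneg _) (hM a y) 2⟩ with hW
  have hWint : ∫ y, (W : Y → ℝ) y ∂ν = 0 := by
    have hi : Integrable (fun p : G × Y => (β₀ p.1 p.2 - c) ^ 2) (μ.prod ν) :=
      h.integrable_sq hD2 hbD
    change ∫ y, (∫ a, (β₀ a y - c) ^ 2 ∂μ - v) ∂ν = 0
    rw [integral_sub hi.integral_prod_right (integrable_const _), hv, cocycleVariance,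
      integral_prod_symm _ hi]
    simp
  filter_upwards [ae_isAlmostCoboundaryAt hν hν_erg hWint] with x hx F hF hFb
  exact tendsto_integral_convPow_gaussianReal h.cocycle hDM hDM2 hM hmean hv0 hx
    (σ := fun g => b g x) (fun g => hbM g x) hF hFb

end Centering

/-! ### Busemann cocycles and Gromov products -/

section Busemann

variable {X : Type*} [AsymMetricSpace X] {s : Direction} {o : X}

theorem abs_horofunction_le (s : Direction) (o w z : X) : |horofunction s o w z| ≤ dist z o := by
  have hd : dist z o = max (adist z o) (adist o z) := rfl
  change |ddist s z w - ddist s o w| ≤ _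
  rw [hd, abs_le]
  have h1 := le_max_left (adist z o) (adist o z)
  have h2 := le_max_right (adist z o) (adist o z)
  cases s
  · have h3 := adist_triangle z o w
    have h4 := adist_triangle o z w
    simp only [ddist]
    constructor <;> linarith
  · have h3 := adist_triangle w o z
    have h4 := adist_triangle w z o
    simp only [ddist]
    constructor <;> linarith

theorem HoroBoundary.abs_apply_le (x : HoroBoundary s o) (z : X) : |x z| ≤ dist z o := by
  have hc : IsClosed {h : C(X, ℝ) | |h z| ≤ dist z o} :=
    isClosed_le (continuous_eval_const z).abs continuous_const
  refine closure_minimal ?_ hc x.2.1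
  rintro _ ⟨w, rfl⟩
  exact abs_horofunction_le s o w z

theorem HoroBoundary.continuous_apply (z : X) : Continuous fun x : HoroBoundary s o => x z :=
  (continuous_eval_const z).comp (continuous_subtype_val (p := (· ∈ horoboundarySet s o)))

variable {G : Type*} [Group G] [MulAction G X]

theorem measurable_busemann (g : G) : Measurable fun x : HoroBoundary s o => busemann g x :=
  (HoroBoundary.continuous_apply _).measurable

/-- Each term of the orbit product is bounded by the Gromov product. -/
theorem orbitProductTerm_le_gromovProduct {x : HoroBoundary .bwd o} {y : HoroBoundary .fwd o}
    (g : G) :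
    ((-(busemann g x + busemann g y) / 2 : ℝ) : EReal) ≤ gromovProduct x y := by
  have h1 : (⨅ z : X, ((x z + y z : ℝ) : EReal)) ≤ ((busemann g x + busemann g y : ℝ) : EReal) :=
    iInf_le (fun z : X => ((x z + y z : ℝ) : EReal)) (g⁻¹ • o)
  have h2 : ((-(busemann g x + busemann g y) / 2 : ℝ) : EReal) =
      ((-(1 / 2) : ℝ) : EReal) * ((busemann g x + busemann g y : ℝ) : EReal) := by
    rw [← EReal.coe_mul]
    congr 1
    ring
  rw [h2, gromovProduct, EReal.coe_neg, EReal.neg_mul, EReal.neg_mul, EReal.neg_le_neg_iff]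
  exact mul_le_mul_of_nonneg_left h1 (by exact_mod_cast (by norm_num : (0 : ℝ) ≤ 1 / 2))

variable [IsAsymIsometricAction G X]

theorem HoroBoundary.smul_apply (g : G) (x : HoroBoundary s o) (z : X) :
    (g • x) z = x (g⁻¹ • z) - x (g⁻¹ • o) := rfl

theorem busemann_mul (g h : G) (x : HoroBoundary s o) :
    busemann (g * h) x = busemann g (h • x) + busemann h x := by
  simp only [busemann, HoroBoundary.smul_apply, mul_inv_rev, mul_smul]
  ring

theorem dist_inv_smul_base (g : G) : dist (g⁻¹ • o) o = dist (g • o) o := by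
  change max (ddist .fwd (g⁻¹ • o) o) (ddist .bwd (g⁻¹ • o) o) =
    max (ddist .bwd o (g • o)) (ddist .fwd o (g • o))
  rw [ddist_inv_smul, ddist_inv_smul, max_comm]

theorem abs_busemann_le (g : G) (x : HoroBoundary s o) : |busemann g x| ≤ dist (g • o) o :=
  (x.abs_apply_le _).trans_eq (dist_inv_smul_base g)

instance HoroBoundary.measurableConstSMul : MeasurableConstSMul G (HoroBoundary s o) where
  measurable_const_smul g := by
    refine Continuous.measurable ?_
    exact continuous_induced_rng.2 ((continuous_horoTranslate o g).comp
      (continuous_subtype_val (p := (· ∈ horoboundarySet s o))))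

instance SubMulAction.measurableConstSMul (S : SubMulAction G (HoroBoundary s o)) :
    MeasurableConstSMul G S where
  measurable_const_smul g :=
    ((measurable_const_smul g).comp measurable_subtype_coe).subtype_mk

theorem EReal.coe_ciSup_le {ι : Type*} [Nonempty ι] {f : ι → ℝ} {P : EReal}
    (hf : ∀ i, (f i : EReal) ≤ P) : ((⨆ i, f i : ℝ) : EReal) ≤ P := by
  induction P with
  | bot => exact absurd (le_bot_iff.1 (hf (Classical.arbitrary ι))) (EReal.coe_ne_bot _)
  | top => exact le_top
  | coe r => exact EReal.coe_le_coe_iff.2 (ciSup_le fun i => EReal.coe_le_coe_iff.1 (hf i))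

theorem EReal.eq_top_of_not_bddAbove {ι : Type*} [Nonempty ι] {f : ι → ℝ} {P : EReal}
    (hf : ∀ i, (f i : EReal) ≤ P) (hbd : ¬ BddAbove (Set.range f)) : P = ⊤ := by
  induction P with
  | bot => exact absurd (le_bot_iff.1 (hf (Classical.arbitrary ι))) (EReal.coe_ne_bot _)
  | top => rfl
  | coe r =>
    refine absurd ⟨r, ?_⟩ hbd
    rintro _ ⟨i, rfl⟩
    exact EReal.coe_le_coe_iff.1 (hf i)

end Busemann

/-- Integrability of a nonnegative function from a summable tail along an arithmetic progression. -/
theorem integrable_of_summable_measureReal_le {Z : Type*} [MeasurableSpace Z] {m : Measure Z}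
    [IsFiniteMeasure m] {f : Z → ℝ} (hf : Measurable f) (hf0 : ∀ z, 0 ≤ f z) {α : ℝ} (hα : 0 < α)
    {C : ℕ → ℝ} (hC : Summable C) (hfC : ∀ n : ℕ, m.real {z | α * n ≤ f z} ≤ C n) :
    Integrable f m ∧ ∫ z, f z ∂m ≤ α * ∑' n, C n := by
  have hC0 : ∀ n, 0 ≤ C n := fun n => measureReal_nonneg.trans (hfC n)
  have hS : ∀ n : ℕ, MeasurableSet {z | α * n ≤ f z} := fun n =>
    measurableSet_le measurable_const hf
  have hpt : ∀ z, ENNReal.ofReal (f z) ≤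
      ∑' n : ℕ, {z | α * n ≤ f z}.indicator (fun _ => ENNReal.ofReal α) z := by
    intro z
    set N := ⌊f z / α⌋₊ + 1 with hN
    have h1 : f z ≤ N * α := by
      have := Nat.lt_floor_add_one (f z / α)
      rw [div_lt_iff₀ hα] at this
      push_cast [hN]
      exact this.le
    calc ENNReal.ofReal (f z) ≤ ENNReal.ofReal (N * α) := ENNReal.ofReal_le_ofReal h1
      _ = ∑ n ∈ Finset.range N, {z | α * n ≤ f z}.indicator (fun _ => ENNReal.ofReal α) z := by
        have h2 : ∀ n ∈ Finset.range N,
            {z | α * n ≤ f z}.indicator (fun _ => ENNReal.ofReal α) z = ENNReal.ofReal α := by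
          intro n hn
          refine Set.indicator_of_mem ?_ _
          have h3 : n ≤ ⌊f z / α⌋₊ := Nat.lt_succ_iff.1 (Finset.mem_range.1 hn)
          have h4 : (n : ℝ) ≤ f z / α :=
            (Nat.cast_le.2 h3).trans (Nat.floor_le (div_nonneg (hf0 z) hα.le))
          change α * n ≤ f z
          rw [mul_comm]
          exact (le_div_iff₀ hα).1 h4
        rw [Finset.sum_congr rfl h2, Finset.sum_const, Finset.card_range, nsmul_eq_mul,
          ENNReal.ofReal_mul N.cast_nonneg, ENNReal.ofReal_natCast]
      _ ≤ _ := ENNReal.sum_le_tsum _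
  have hlint : ∫⁻ z, ENNReal.ofReal (f z) ∂m ≤ ENNReal.ofReal (α * ∑' n, C n) := by
    calc ∫⁻ z, ENNReal.ofReal (f z) ∂m
        ≤ ∫⁻ z, ∑' n : ℕ, {z | α * n ≤ f z}.indicator (fun _ => ENNReal.ofReal α) z ∂m :=
          lintegral_mono hpt
      _ = ∑' n : ℕ, ENNReal.ofReal α * m {z | α * n ≤ f z} := by
          rw [lintegral_tsum fun n => (measurable_const.indicator (hS n)).aemeasurable]
          simp_rw [lintegral_indicator_const (hS _)]
      _ ≤ ∑' n : ℕ, ENNReal.ofReal α * ENNReal.ofReal (C n) := by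
          refine ENNReal.tsum_le_tsum fun n => ?_
          rw [← ofReal_measureReal (μ := m)]
          exact mul_le_mul_right (ENNReal.ofReal_le_ofReal (hfC n)) _
      _ = ENNReal.ofReal (α * ∑' n, C n) := by
          rw [ENNReal.tsum_mul_left, ← ENNReal.ofReal_tsum_of_nonneg hC0 hC,
            ENNReal.ofReal_mul hα.le]
  have hint : Integrable f m := by
    refine ⟨hf.aestronglyMeasurable, ?_⟩
    rw [hasFiniteIntegral_iff_ofReal (Eventually.of_forall hf0)]
    exact hlint.trans_lt ENNReal.ofReal_lt_top
  refine ⟨hint, ?_⟩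
  rw [integral_eq_lintegral_of_nonneg_ae (Eventually.of_forall hf0) hf.aestronglyMeasurable]
  exact ENNReal.toReal_le_of_le_ofReal (mul_nonneg hα.le (tsum_nonneg hC0)) hlint

/-! ### The central limit theorem for the Busemann cocycle -/

theorem theorem1p3
    {X : Type*} [AsymMetricSpace X] (hX : IsGeodesicSpace X) (o : X)
    {G : Type*} [Group G] [Countable G] [MeasurableSpace G] [DiscreteMeasurableSpace G]
    [MulAction G X] [IsAsymIsometricAction G X]
    (μ : Measure G) [IsProbabilityMeasure μ]
    -- finite second moment for the symmetrized metric
    (hμ : Integrable (fun g : G => dist (g • o) o ^ 2) μ)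
    -- invariant subsets of the two horoboundaries
    (Yminus : SubMulAction G (HoroBoundary Direction.bwd o))
    (hYminus : MeasurableSet (Yminus : Set (HoroBoundary Direction.bwd o)))
    (Yplus : SubMulAction G (HoroBoundary Direction.fwd o))
    (ν : Measure Yminus) [IsProbabilityMeasure ν]
    (hν : IsStationaryMeasure μ ν) (hν_erg : IsWalkErgodic μ ν)
    (νstar : Measure Yplus) [IsProbabilityMeasure νstar]
    (hνstar : IsStationaryMeasure μ.inv νstar)
    -- (H1)
    (lam : ℝ)
    (H1 : ∫ p : G × Yplus, busemann p.1 (p.2 : HoroBoundary Direction.fwd o) ∂(μ.inv.prod νstar)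
      = lam)
    -- (H2)
    (H2 : ∃ α : ℝ, 0 < α ∧ ∃ C : ℕ → ℝ, Summable C ∧ ∀ (x : Yminus) (n : ℕ),
      νstar.real {y : Yplus | ((α * n : ℝ) : EReal) ≤
        gromovProduct (x : HoroBoundary Direction.bwd o) (y : HoroBoundary Direction.fwd o)} ≤ C n) :
    IsCenterable μ (fun g (x : Yminus) => busemann g (x : HoroBoundary Direction.bwd o)) lam ∧
    ∀ (β₀ : G → Yminus → ℝ) (ψ : Yminus → ℝ) (c : ℝ),
      IsCentering μ (fun g (x : Yminus) => busemann g (x : HoroBoundary Direction.bwd o)) β₀ ψ c →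
      c = lam ∧
      Integrable (fun p : G × Yminus => (β₀ p.1 p.2 - lam) ^ 2) (μ.prod ν) ∧
      ∀ᵐ x : Yminus ∂ν, ∀ F : ℝ → ℝ, Continuous F → HasCompactSupport F →
        Tendsto
          (fun n : ℕ => ∫ g, F ((busemann g (x : HoroBoundary Direction.bwd o) - n * lam) / √n)
            ∂(convPow μ n))
          atTop
          (𝓝 (∫ t, F t ∂(gaussianReal 0 (cocycleVariance μ ν β₀ lam).toNNReal))) := by
  obtain ⟨α, hα, C, hC, hC2⟩ := H2
  set b : G → Yminus → ℝ := fun g x => busemann g (x : HoroBoundary Direction.bwd o) with hb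
  set b' : G → Yplus → ℝ := fun g y => busemann g (y : HoroBoundary Direction.fwd o) with hb'
  set D : G → ℝ := fun g => dist (g • o) o with hD
  have hbD : ∀ g x, |b g x| ≤ D g := fun g x => abs_busemann_le g _
  have hbD' : ∀ g y, |b' g y| ≤ D g := fun g y => abs_busemann_le g _
  have hbc : IsCocycle b := fun g h x => busemann_mul g h _
  have hbc' : IsCocycle b' := fun g h x => busemann_mul g h _
  have hbm : ∀ g, Measurable (b g) := fun g => (measurable_busemann g).comp measurable_subtype_coe
  have hbm' : ∀ g, Measurable (b' g) := fun g => (measurable_busemann g).comp measurable_subtype_coe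
  have hle : ∀ (x : Yminus) (y : Yplus) (g : G), (orbitProductTerm b b' x y g : EReal) ≤
      gromovProduct (x : HoroBoundary Direction.bwd o) (y : HoroBoundary Direction.fwd o) :=
    fun x y g => orbitProductTerm_le_gromovProduct g
  have hfin : ∀ x, ∀ᵐ y ∂νstar, BddAbove (Set.range (orbitProductTerm b b' x y)) := by
    intro x
    rw [ae_iff, ← measureReal_eq_zero_iff]
    -- where the supremum over the orbit is infinite, the Gromov product exceeds every `α n`
    refine le_antisymm (ge_of_tendsto' hC.tendsto_atTop_zero fun n => ?_) measureReal_nonneg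
    refine (measureReal_mono fun y hy => ?_).trans (hC2 x n)
    have htop := EReal.eq_top_of_not_bddAbove (hle x y) hy
    change _ ≤ gromovProduct _ _
    rw [htop]
    exact le_top
  -- the restricted Gromov product is at most the full one, so it inherits the tail bound
  have hint : ∀ x, Integrable (orbitProduct b b' x) νstar ∧
      ∫ y, orbitProduct b b' x y ∂νstar ≤ α * ∑' n, C n := by
    intro x
    refine integrable_of_summable_measureReal_le
      ((measurable_orbitProduct hbm hbm').comp measurable_prodMk_left)
      (fun y => orbitProduct_nonneg hbc hbc' x y) hα hC fun n => ?_
    refine (measureReal_mono fun y hy => ?_).trans (hC2 x n)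
    exact (EReal.coe_le_coe_iff.2 hy).trans (EReal.coe_ciSup_le (hle x y))
  have hcent : IsCenterable μ b lam := by
    rw [← H1]
    exact isCenterable_of_orbitProduct μ hbc hbc' hbm hbm' (integrable_of_integrable_sq hμ) hbD hbD'
      (fun g => dist_inv_smul_base g) hνstar hfin (fun x => (hint x).1) fun x => (hint x).2
  refine ⟨hcent, fun β₀ ψ c h => ?_⟩
  obtain ⟨β₁, ψ₁, h₁⟩ := hcent
  obtain rfl : c = lam := h.drift_unique hν h₁
  refine ⟨rfl, h.integrable_sq hμ hbD, ?_⟩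
  filter_upwards [h.ae_tendsto_gaussianReal hν hν_erg hμ hbD] with x hx F hF hFc
  exact hx F hF (hF.bounded_above_of_compact_support hFc)
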